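/- Let $K$ be a field, $S=K[x_1,\ldots,x_n]$, and order monomials lexicographically with $x_1>x_2>\cdots>x_n$. Let $u=x_1x_i$ with $2\le i\le n$ and $v=x_jx_k$ with $2\le j<k\le n$, let $$L(u,v)=\{w : w \text{ a squarefree monomial of degree } 2 \text{ in } S,\ u\ge_{\mathrm{lex}} w\ge_{\mathrm{lex}} v\},$$ and let $I\subset S$ be the ideal generated by $L(u,v)$. Let $\operatorname{depth}(S/I)$ denote the supremum of the lengths of $S/I$-regular sequences contained in $(x_1,\ldots,x_n)$. Then: 1. $\operatorname{depth}(S/I)=1$ if and only if $x_{i-1}x_n\ge_{\mathrm{lex}} v$. 2. $\operatorname{projdim}_S(S/I)=n-1$ if and only if $x_{i-1}x_n\ge_{\mathrm{lex}} v$. 3. The Stanley–Reisner complex $\Delta$ of $I$, i.e. the simplicial complex whose faces are the sets $F\subseteq\{1,\ldots,n\}$ with $\prod_{s\in F}x_s\notin I$, is disconnected (its vertex set is a union of two disjoint nonempty sets such that no face of $\Delta$ meets both) if and only if $x_{i-1}x_n\ge_{\mathrm{lex}} v$. -/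

import Mathlib

open scoped MonomialOrder

noncomputable section

namespace LexsegmentEdge

/-- The index in `Fin n` of the variable `x_a`, where `1 ≤ a ≤ n`
(variables are numbered `x_1, …, x_n`). -/
def idx (n a : ℕ) (h : 1 ≤ a ∧ a ≤ n) : Fin n := ⟨a - 1, by omega⟩

/-- The exponent vector of the monomial `x_a x_b`. -/
def quad {n : ℕ} (a b : Fin n) : Fin n →₀ ℕ := Finsupp.single a 1 + Finsupp.single b 1

/-- The lexsegment `L(u,v)`: the exponent vectors `w` of the squarefree monomials of degree `2`
with `u ≥_lex w ≥_lex v`. In `MonomialOrder.lex` the variable with the smallest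
index is the largest one, so that `x_1 > x_2 > ⋯ > x_n`. -/
def lexsegment {n : ℕ} (u v : Fin n →₀ ℕ) : Set (Fin n →₀ ℕ) :=
  {w | (∀ t, w t ≤ 1) ∧ w.degree = 2 ∧ w ≼[MonomialOrder.lex] u ∧ v ≼[MonomialOrder.lex] w}

/-- The ideal `(L(u,v))` of `K[x_1, …, x_n]` generated by the monomials in `L(u,v)`. -/
def lexsegmentIdeal (K : Type*) [Field K] {n : ℕ} (u v : Fin n →₀ ℕ) :
    Ideal (MvPolynomial (Fin n) K) :=
  Ideal.span ((fun w => MvPolynomial.monomial w (1 : K)) '' lexsegment u v)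

/-- The depth of `M` with respect to the ideal `J`: the supremum of the lengths of the
`M`-regular sequences consisting of elements of `J`. -/
def depth {R : Type*} [CommRing R] (J : Ideal R) (M : Type*) [AddCommGroup M] [Module R M] :
    ℕ∞ :=
  ⨆ (rs : List R) (_ : (∀ r ∈ rs, r ∈ J) ∧ RingTheory.Sequence.IsRegular M rs),
    (rs.length : ℕ∞)

/-- The Stanley–Reisner complex of an ideal `I` of `K[x_s : s ∈ σ]`: its (nonempty) faces are
the nonempty finite sets `F` such that the squarefree monomial `∏_{s ∈ F} x_s` is not in `I`. -/
def stanleyReisner {K : Type*} [Field K] {σ : Type*} (I : Ideal (MvPolynomial σ K)) :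
    PreAbstractSimplicialComplex σ where
  faces := {F | F.Nonempty ∧ ∏ s ∈ F, (MvPolynomial.X s : MvPolynomial σ K) ∉ I}
  isRelLowerSet_faces := by
    rintro F ⟨hF, hI⟩
    refine ⟨hF, fun G hGF hG => ⟨hG, fun hGI => hI ?_⟩⟩
    exact I.mem_of_dvd (Finset.prod_dvd_prod_of_subset G F _ hGF) hGI

/-- A simplicial complex is disconnected if its vertex set is the union of two disjoint nonempty
sets such that no face has vertices in both of them. -/
def IsDisconnected {σ : Type*} (Δ : PreAbstractSimplicialComplex σ) : Prop :=
  ∃ V₁ V₂ : Set σ, V₁.Nonempty ∧ V₂.Nonempty ∧ Disjoint V₁ V₂ ∧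
    V₁ ∪ V₂ = {s | ({s} : Finset σ) ∈ Δ} ∧ ∀ F ∈ Δ, (F : Set σ) ⊆ V₁ ∨ (F : Set σ) ⊆ V₂

end LexsegmentEdge

end

/-! `I` is the face ideal of a complex Δ on all `n` vertices, and its generators are the missing
edges. Depth, projective dimension and the lex condition are each tied to whether Δ is connected.

Homology is controlled by 0 → S/I_star → S/I_Δ → S/I_del → 0 for a vertex b, since I_Δ : x_b is the
face ideal of the closed star and I_Δ + (x_b) that of the deletion. Properties that pass to
extensions are thus reduced to simplices, whose face ideals are generated by variables
(`complex_induction`). With f = ∑ x_s, a complex with a vertex has projective dimension at most n-1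
and f regular; a cone with two vertices has projective dimension at most n-2 and no socle modulo f.
A connected complex grows from an edge by adding adjacent vertices, whose stars are cones
(`IsConnected.induction`), so it inherits these bounds and has depth at least 2.

If Δ splits into two parts, then I = A ∩ B and A + B = m = (x_1,…,x_n). The sequence 0 → S/I → S/A ×
S/B → S/m → 0 and pd S/m ≥ n force pd S/I = n-1. For f = p + q regular with p ∈ A and q ∈ B, the
class of p is a nonzero socle element modulo f, so the depth is 1.

Finally, the products x_a x_b with a < i ≤ b range in lex order from u down to x_{i-1} x_n. If the
latter is ≥ v, they are all generators and {1,…,i-1} is separated from the rest; otherwise faces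
through x_1 and x_n connect everything. -/

set_option linter.unusedSectionVars false

/-! ### Face ideals, stars and deletions. -/

noncomputable section

namespace FaceIdeal

open MvPolynomial

variable {σ : Type} [DecidableEq σ]

/-- The closed star of the vertex `b` in the complex `Δ`. -/
def star (Δ : Finset (Finset σ)) (b : σ) : Finset (Finset σ) := Δ.filter fun F => insert b F ∈ Δ

/-- The deletion of the vertex `b` from the complex `Δ`. -/
def del (Δ : Finset (Finset σ)) (b : σ) : Finset (Finset σ) := Δ.filter fun F => b ∉ F

theorem isLowerSet_star {Δ : Finset (Finset σ)} (hΔ : IsLowerSet (Δ : Set (Finset σ))) (b : σ) :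
    IsLowerSet (star Δ b : Set (Finset σ)) := by
  intro F G hGF hF
  simp only [star, Finset.coe_filter, Set.mem_ofPred_eq] at hF ⊢
  exact ⟨hΔ hGF hF.1, hΔ (Finset.insert_subset_insert b hGF) hF.2⟩

theorem isLowerSet_del {Δ : Finset (Finset σ)} (hΔ : IsLowerSet (Δ : Set (Finset σ))) (b : σ) :
    IsLowerSet (del Δ b : Set (Finset σ)) := by
  intro F G hGF hF
  simp only [del, Finset.coe_filter, Set.mem_ofPred_eq] at hF ⊢
  exact ⟨hΔ hGF hF.1, fun h => hF.2 (hGF h)⟩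

theorem isLowerSet_powerset (W : Finset σ) :
    IsLowerSet ((W.powerset : Finset (Finset σ)) : Set (Finset σ)) := by
  intro F G hGF hF
  simp only [Finset.coe_powerset, Set.mem_preimage, Set.mem_powerset_iff, Finset.coe_subset]
    at hF ⊢
  exact hGF.trans hF

theorem mem_star_iff {Δ : Finset (Finset σ)} (hΔ : IsLowerSet (Δ : Set (Finset σ))) {b : σ}
    {F : Finset σ} : F ∈ star Δ b ↔ insert b F ∈ Δ := by
  simp only [star, Finset.mem_filter, and_iff_right_iff_imp]
  exact fun h => hΔ (Finset.subset_insert b F) h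

theorem mem_del_iff {Δ : Finset (Finset σ)} {b : σ} {F : Finset σ} :
    F ∈ del Δ b ↔ F ∈ Δ ∧ b ∉ F := by
  simp [del]

/-- A complex all of whose vertices are cone points is a simplex. -/
theorem eq_powerset_of_forall_star_eq [Fintype σ] {Δ : Finset (Finset σ)}
    (hΔ : IsLowerSet (Δ : Set (Finset σ))) (h0 : ∅ ∈ Δ) (h : ∀ b, {b} ∈ Δ → star Δ b = Δ) :
    Δ = (Finset.univ.filter fun b => {b} ∈ Δ).powerset := by
  ext F
  simp only [Finset.mem_powerset]
  constructor
  · intro hF a ha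
    simpa using hΔ (Finset.singleton_subset_iff.2 ha) hF
  · intro hF
    induction F using Finset.induction_on with
    | empty => exact h0
    | insert a F ha ih =>
      rw [Finset.insert_subset_iff] at hF
      have h1 := ih hF.2
      rwa [← h a (by simpa using hF.1), mem_star_iff hΔ] at h1

/-- Induction on the number of faces. A complex whose vertices are all cone points is a simplex; at
any other vertex both the star and the deletion have fewer faces. The class `C` need only be stable
at such vertices. -/
theorem complex_induction [Fintype σ] {C P : Finset (Finset σ) → Prop}
    (hC0 : ∀ Δ, C Δ → ∅ ∈ Δ)
    (hC : ∀ Δ : Finset (Finset σ), IsLowerSet (Δ : Set (Finset σ)) → C Δ → ∀ b, {b} ∈ Δ →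
      star Δ b ≠ Δ → C (star Δ b) ∧ C (del Δ b))
    (base : ∀ W : Finset σ, C W.powerset → P W.powerset)
    (step : ∀ Δ : Finset (Finset σ), IsLowerSet (Δ : Set (Finset σ)) → ∀ b,
      C (del Δ b) → P (star Δ b) → P (del Δ b) → P Δ)
    (Δ : Finset (Finset σ)) (hΔ : IsLowerSet (Δ : Set (Finset σ))) (h : C Δ) : P Δ := by
  induction hn : Δ.card using Nat.strong_induction_on generalizing Δ with
  | _ m ih =>
    by_cases hall : ∀ b, {b} ∈ Δ → star Δ b = Δ
    · have := eq_powerset_of_forall_star_eq hΔ (hC0 Δ h) hall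
      rw [this] at h ⊢
      exact base _ h
    · push Not at hall
      obtain ⟨b, hb, hne⟩ := hall
      obtain ⟨h1, h2⟩ := hC Δ hΔ h b hb hne
      refine step Δ hΔ b h2 (ih _ ?_ _ (isLowerSet_star hΔ b) h1 rfl)
        (ih _ ?_ _ (isLowerSet_del hΔ b) h2 rfl)
      · rw [← hn]
        exact Finset.card_lt_card ((Finset.filter_subset _ _).ssubset_of_ne hne)
      · rw [← hn]
        refine Finset.card_lt_card ((Finset.filter_subset _ _).ssubset_of_ne fun h => ?_)
        rw [← h] at hb
        simp at hb

variable (K : Type*) [Field K]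

/-- The ideal generated by the monomials whose support is not a face of `Δ`. -/
def faceIdeal (Δ : Finset (Finset σ)) : Ideal (MvPolynomial σ K) :=
  Ideal.span ((fun w => monomial w (1 : K)) '' {w | w.support ∉ Δ})

variable {K}

theorem mem_faceIdeal {Δ : Finset (Finset σ)} (hΔ : IsLowerSet (Δ : Set (Finset σ)))
    {p : MvPolynomial σ K} : p ∈ faceIdeal K Δ ↔ ∀ m ∈ p.support, m.support ∉ Δ := by
  rw [faceIdeal, mem_ideal_span_monomial_image]
  refine forall₂_congr fun m _ => ⟨?_, fun h => ⟨m, h, le_rfl⟩⟩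
  rintro ⟨w, hw, hwm⟩ hm
  exact hw (hΔ (Finsupp.support_mono hwm) hm)

/-- Multiplying a monomial by `X b` inserts `b` into its support; this identifies the colon ideal.
-/
theorem X_mul_mem_faceIdeal {Δ : Finset (Finset σ)} (hΔ : IsLowerSet (Δ : Set (Finset σ)))
    (b : σ) {p : MvPolynomial σ K} :
    X b * p ∈ faceIdeal K Δ ↔ p ∈ faceIdeal K (star Δ b) := by
  rw [mem_faceIdeal hΔ, mem_faceIdeal (isLowerSet_star hΔ b), support_X_mul]
  simp only [Finset.mem_map, addLeftEmbedding_apply, forall_exists_index, and_imp,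
    forall_apply_eq_imp_iff₂, mem_star_iff hΔ]
  refine forall₂_congr fun m _ => ?_
  have : (Finsupp.single b 1 + m).support = insert b m.support := by
    ext t
    simp only [Finsupp.mem_support_iff, Finsupp.add_apply, Finset.mem_insert,
      Finsupp.single_apply]
    split_ifs with h
    · simp [h]
    · simp [Ne.symm h]
  rw [this]

theorem faceIdeal_mono {Δ Γ : Finset (Finset σ)} (h : Γ ⊆ Δ) : faceIdeal K Δ ≤ faceIdeal K Γ :=
  Ideal.span_mono (Set.image_mono fun _ hw hm => hw (h hm))

theorem faceIdeal_del (Δ : Finset (Finset σ)) (b : σ) :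
    faceIdeal K (del Δ b) = faceIdeal K Δ ⊔ Ideal.span {X b} := by
  apply le_antisymm
  · rw [faceIdeal, Ideal.span_le]
    rintro _ ⟨w, hw, rfl⟩
    simp only [Set.mem_ofPred_eq, mem_del_iff, not_and_or, not_not] at hw
    rcases hw with hw | hw
    · exact Ideal.mem_sup_left (Ideal.subset_span ⟨w, hw, rfl⟩)
    · refine Ideal.mem_sup_right (Ideal.mem_span_singleton.2 ?_)
      rw [X_dvd_monomial]
      exact Or.inr (Finsupp.mem_support_iff.1 hw)
  · refine sup_le (faceIdeal_mono (Finset.filter_subset _ _)) ?_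
    rw [Ideal.span_singleton_le_iff_mem]
    refine Ideal.subset_span ⟨Finsupp.single b 1, ?_, rfl⟩
    simp [mem_del_iff]

theorem mem_sup_span_singleton {R : Type*} [CommRing R] {J : Ideal R} {x p : R} :
    p ∈ J ⊔ Ideal.span {x} ↔ ∃ q ∈ J, ∃ r, p = q + x * r := by
  simp only [Submodule.mem_sup, Ideal.mem_span_singleton]
  constructor
  · rintro ⟨q, hq, _, ⟨r, rfl⟩, rfl⟩
    exact ⟨q, hq, r, rfl⟩
  · rintro ⟨q, hq, r, rfl⟩
    exact ⟨q, hq, _, ⟨r, rfl⟩, rfl⟩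

theorem mem_faceIdeal_del {Δ : Finset (Finset σ)} {b : σ} {p : MvPolynomial σ K} :
    p ∈ faceIdeal K (del Δ b) ↔ ∃ q ∈ faceIdeal K Δ, ∃ r, p = q + X b * r := by
  rw [faceIdeal_del, mem_sup_span_singleton]

theorem X_mem_faceIdeal {Δ : Finset (Finset σ)} (hΔ : IsLowerSet (Δ : Set (Finset σ))) {b : σ} :
    (X b : MvPolynomial σ K) ∈ faceIdeal K Δ ↔ {b} ∉ Δ := by
  rw [mem_faceIdeal hΔ]
  simp [support_X]

/-! ### Regular elements -/

/-- Nonzerodivisors on the two ends of 0 → S/I_star → S/I_Δ → S/I_del → 0 are nonzerodivisors in the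
middle. -/
theorem regular_step {h : MvPolynomial σ K} {Δ : Finset (Finset σ)}
    (hΔ : IsLowerSet (Δ : Set (Finset σ))) (b : σ)
    (hs : ∀ z, h * z ∈ faceIdeal K (star Δ b) → z ∈ faceIdeal K (star Δ b))
    (hd : ∀ z, h * z ∈ faceIdeal K (del Δ b) → z ∈ faceIdeal K (del Δ b))
    (z : MvPolynomial σ K) (hz : h * z ∈ faceIdeal K Δ) : z ∈ faceIdeal K Δ := by
  obtain ⟨q, hq, y, rfl⟩ := mem_faceIdeal_del.1
    (hd z (faceIdeal_mono (Finset.filter_subset _ _) hz))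
  refine Ideal.add_mem _ hq ((X_mul_mem_faceIdeal hΔ b).2 (hs y ?_))
  rw [← X_mul_mem_faceIdeal hΔ b]
  have : X b * (h * y) = h * (q + X b * y) - h * q := by ring
  rw [this]
  exact Ideal.sub_mem _ hz (Ideal.mul_mem_left _ _ hq)

/-- Since `f` is regular on the deletion's quotient, the star–deletion sequence stays exact modulo
`f`. A module with zero socle at both ends has zero socle in the middle. -/
theorem socle_step {f : MvPolynomial σ K} {Δ : Finset (Finset σ)}
    (hΔ : IsLowerSet (Δ : Set (Finset σ))) (b : σ)
    (hreg : ∀ z, f * z ∈ faceIdeal K (del Δ b) → z ∈ faceIdeal K (del Δ b))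
    (hs : ∀ z, (∀ s, X s * z ∈ faceIdeal K (star Δ b) ⊔ Ideal.span {f}) →
      z ∈ faceIdeal K (star Δ b) ⊔ Ideal.span {f})
    (hd : ∀ z, (∀ s, X s * z ∈ faceIdeal K (del Δ b) ⊔ Ideal.span {f}) →
      z ∈ faceIdeal K (del Δ b) ⊔ Ideal.span {f})
    (z : MvPolynomial σ K) (hz : ∀ s, X s * z ∈ faceIdeal K Δ ⊔ Ideal.span {f}) :
    z ∈ faceIdeal K Δ ⊔ Ideal.span {f} := by
  obtain ⟨w, hw, g, rfl⟩ := mem_sup_span_singleton.1 (hd z fun s =>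
    sup_le_sup_right (faceIdeal_mono (Finset.filter_subset _ _)) _ (hz s))
  obtain ⟨q, hq, y, rfl⟩ := mem_faceIdeal_del.1 hw
  have hy : y ∈ faceIdeal K (star Δ b) ⊔ Ideal.span {f} := by
    refine hs y fun s => ?_
    obtain ⟨q', hq', h, hh⟩ := mem_sup_span_singleton.1 (hz s)
    have h1 : f * (h - X s * g) ∈ faceIdeal K (del Δ b) := by
      refine mem_faceIdeal_del.2 ⟨X s * q - q', Ideal.sub_mem _ (Ideal.mul_mem_left _ _ hq) hq',
        X s * y, ?_⟩
      linear_combination -hh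
    obtain ⟨q'', hq'', h', hh'⟩ := mem_faceIdeal_del.1 (hreg _ h1)
    refine mem_sup_span_singleton.2 ⟨X s * y - f * h', ?_, h', by ring⟩
    rw [← X_mul_mem_faceIdeal hΔ]
    have : X b * (X s * y - f * h') = q' + f * q'' - X s * q := by
      linear_combination hh + f * hh'
    rw [this]
    exact Ideal.sub_mem _ (Ideal.add_mem _ hq' (Ideal.mul_mem_left _ _ hq''))
      (Ideal.mul_mem_left _ _ hq)
  obtain ⟨t, ht, l, rfl⟩ := mem_sup_span_singleton.1 hy
  refine mem_sup_span_singleton.2 ⟨q + X b * t, Ideal.add_mem _ hq ((X_mul_mem_faceIdeal hΔ b).2 ht),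
    X b * l + g, by ring⟩

/-- An ideal that contains `φ X_s - X_s` for all `s` and lies in the kernel of the endomorphism `φ`
is equal to that kernel. -/
theorem eq_ker_of_aeval {J : Ideal (MvPolynomial σ K)} (φ : MvPolynomial σ K →ₐ[K] MvPolynomial σ K)
    (h1 : J ≤ RingHom.ker φ) (h2 : ∀ s, φ (X s) - X s ∈ J) : J = RingHom.ker φ := by
  refine le_antisymm h1 fun p hp => ?_
  have : (Ideal.Quotient.mkₐ K J).comp φ = Ideal.Quotient.mkₐ K J := by
    ext s
    exact Ideal.Quotient.eq.2 (h2 s)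
  have h3 := DFunLike.congr_fun this p
  rw [RingHom.mem_ker] at hp
  rw [AlgHom.comp_apply, hp, map_zero] at h3
  exact Ideal.Quotient.eq_zero_iff_mem.1 h3.symm

theorem faceIdeal_powerset_le_ker (W : Finset σ)
    (φ : MvPolynomial σ K →ₐ[K] MvPolynomial σ K) (h : ∀ s ∉ W, φ (X s) = 0) :
    faceIdeal K W.powerset ≤ RingHom.ker φ := by
  rw [faceIdeal, Ideal.span_le]
  rintro _ ⟨w, hw, rfl⟩
  simp only [Set.mem_ofPred_eq, Finset.mem_powerset, Finset.not_subset] at hw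
  obtain ⟨s, hs, hsW⟩ := hw
  obtain ⟨q, hq⟩ : (X s : MvPolynomial σ K) ∣ monomial w 1 := by
    rw [X_dvd_monomial]
    exact Or.inr (Finsupp.mem_support_iff.1 hs)
  simp [RingHom.mem_ker, hq, h s hsW]

theorem faceIdeal_powerset_isPrime (W : Finset σ) : (faceIdeal K W.powerset).IsPrime := by
  let φ : MvPolynomial σ K →ₐ[K] MvPolynomial σ K := aeval fun s => if s ∈ W then X s else 0
  rw [eq_ker_of_aeval (J := faceIdeal K W.powerset) φ
    (faceIdeal_powerset_le_ker W φ fun s hs => by simp [φ, hs])]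
  · exact RingHom.ker_isPrime φ
  · intro s
    by_cases hs : s ∈ W
    · simp [φ, hs]
    · simp [φ, hs, X_mem_faceIdeal (isLowerSet_powerset W)]

/-- Killing the variables outside `W` and solving ∑ x_s = 0 for x_c leaves a polynomial ring in the
variables of `W.erase c`, where x_d survives. -/
theorem exists_isPrime_sum_X [Fintype σ] {W : Finset σ} {c d : σ} (hc : c ∈ W) (hd : d ∈ W)
    (hcd : c ≠ d) :
    (faceIdeal K W.powerset ⊔ Ideal.span {∑ s, X s}).IsPrime ∧
      X d ∉ faceIdeal K W.powerset ⊔ Ideal.span {∑ s, X s} := by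
  let φ : MvPolynomial σ K →ₐ[K] MvPolynomial σ K :=
    aeval fun s => if s = c then -∑ t ∈ W.erase c, X t else if s ∈ W then X s else 0
  have hsum : (∑ s, X s : MvPolynomial σ K) = ∑ s ∈ Wᶜ, X s + ∑ t ∈ W.erase c, X t + X c := by
    rw [add_assoc, Finset.sum_erase_add _ _ hc, Finset.sum_compl_add_sum]
  have hker : faceIdeal K W.powerset ⊔ Ideal.span {∑ s, X s} = RingHom.ker φ := by
    refine eq_ker_of_aeval φ (sup_le (faceIdeal_powerset_le_ker W φ fun s hs => ?_) ?_) fun s => ?_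
    · have : s ≠ c := fun h => hs (h ▸ hc)
      simp [φ, hs, this]
    · rw [Ideal.span_singleton_le_iff_mem, RingHom.mem_ker, hsum, map_add, map_add, map_sum,
        map_sum]
      rw [Finset.sum_eq_zero, Finset.sum_congr rfl (g := X)]
      · simp [φ]
      · intro s hs
        simp [φ, Finset.ne_of_mem_erase hs, Finset.mem_of_mem_erase hs]
      · intro s hs
        rw [Finset.mem_compl] at hs
        have : s ≠ c := fun h => hs (h ▸ hc)
        simp [φ, hs, this]
    · by_cases hsc : s = c
      · subst hsc
        have : φ (X s) - X s = ∑ t ∈ Wᶜ, X t - ∑ t, X t := by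
          rw [hsum]
          simp only [φ, aeval_X, if_true]
          ring
        rw [this]
        refine Ideal.sub_mem _ (Ideal.mem_sup_left (Ideal.sum_mem _ fun t ht => ?_))
          (Ideal.mem_sup_right (Ideal.mem_span_singleton_self _))
        simpa [X_mem_faceIdeal (isLowerSet_powerset W)] using ht
      · by_cases hs : s ∈ W
        · simp [φ, hsc, hs]
        · refine Ideal.mem_sup_left ?_
          simp [φ, hs, hsc, X_mem_faceIdeal (isLowerSet_powerset W)]
  rw [hker]
  refine ⟨RingHom.ker_isPrime φ, ?_⟩
  simp [RingHom.mem_ker, φ, hcd.symm, hd]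

end FaceIdeal

end

/-! ### Cones, regular elements and the socle. -/

noncomputable section

namespace FaceIdeal

open MvPolynomial

variable {σ : Type} [DecidableEq σ]

theorem exists_insert_notMem {Δ : Finset (Finset σ)} {b : σ} (h : star Δ b ≠ Δ) :
    ∃ F ∈ Δ, insert b F ∉ Δ := by
  by_contra! h'
  exact h (Finset.filter_true_of_mem h')

/-- Deleting a vertex that is not a cone point from a complex with a vertex leaves a vertex. -/
theorem exists_vertex_del {Δ : Finset (Finset σ)} (hΔ : IsLowerSet (Δ : Set (Finset σ))) {b : σ}
    (hb : {b} ∈ Δ) (h : star Δ b ≠ Δ) : ∃ a, {a} ∈ del Δ b := by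
  obtain ⟨F, hF, hbF⟩ := exists_insert_notMem h
  obtain ⟨a, ha⟩ : F.Nonempty := by
    rw [Finset.nonempty_iff_ne_empty]
    rintro rfl
    exact hbF hb
  refine ⟨a, mem_del_iff.2 ⟨hΔ (Finset.singleton_subset_iff.2 ha) hF, ?_⟩⟩
  rw [Finset.mem_singleton]
  rintro rfl
  rw [Finset.insert_eq_of_mem ha] at hbF
  exact hbF hF

theorem singleton_mem_star {Δ : Finset (Finset σ)} (hΔ : IsLowerSet (Δ : Set (Finset σ))) {b : σ}
    (hb : {b} ∈ Δ) : {b} ∈ star Δ b := by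
  rw [mem_star_iff hΔ]
  simpa using hb

/-- A cone with at least two vertices. -/
def IsCone (Δ : Finset (Finset σ)) : Prop := ∃ c v, c ≠ v ∧ {v} ∈ Δ ∧ star Δ c = Δ

theorem IsCone.star_del {Δ : Finset (Finset σ)} (hΔ : IsLowerSet (Δ : Set (Finset σ)))
    (h : IsCone Δ) {b : σ} (hb : {b} ∈ Δ) (hne : star Δ b ≠ Δ) :
    IsCone (star Δ b) ∧ IsCone (del Δ b) := by
  obtain ⟨c, v, hcv, hv, hc⟩ := h
  have hc' (F) (hF : F ∈ Δ) : insert c F ∈ Δ := by rwa [← hc, mem_star_iff hΔ] at hF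
  have hcb : c ≠ b := fun h => hne (h ▸ hc)
  constructor
  · refine ⟨c, b, hcb, singleton_mem_star hΔ hb, Finset.filter_true_of_mem fun F hF => ?_⟩
    rw [mem_star_iff hΔ] at hF ⊢
    rw [Finset.insert_comm]
    exact hc' _ hF
  · obtain ⟨F, hF, hbF⟩ := exists_insert_notMem hne
    -- A face that cannot be joined to `b` has a vertex other than `c`, as {c, b} is itself a face.
    -- This vertex keeps the deletion a cone with two vertices.
    obtain ⟨a, ha, hac⟩ : ∃ a ∈ F, a ≠ c := by
      by_contra! h
      refine hbF (hΔ (?_ : insert b F ⊆ insert c {b}) (hc' _ hb))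
      refine Finset.insert_subset (by simp) fun a ha => by simp [h a ha]
    refine ⟨c, a, hac.symm, mem_del_iff.2 ⟨hΔ (Finset.singleton_subset_iff.2 ha) hF, ?_⟩,
      Finset.filter_true_of_mem fun F hF => ?_⟩
    · rw [Finset.mem_singleton]
      rintro rfl
      rw [Finset.insert_eq_of_mem ha] at hbF
      exact hbF hF
    · rw [mem_del_iff] at hF ⊢
      exact ⟨hc' _ hF.1, by simp [hF.2, hcb.symm]⟩

theorem IsCone.exists_vertex {Δ : Finset (Finset σ)} (h : IsCone Δ) : ∃ v, {v} ∈ Δ :=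
  let ⟨_, v, _, hv, _⟩ := h
  ⟨v, hv⟩

theorem empty_mem {Δ : Finset (Finset σ)} (hΔ : IsLowerSet (Δ : Set (Finset σ))) {F : Finset σ}
    (h : F ∈ Δ) : ∅ ∈ Δ := hΔ (Finset.empty_subset F) h

variable {K : Type*} [Field K]

theorem faceIdeal_singleton_empty [Fintype σ] :
    faceIdeal K (Finset.powerset (∅ : Finset σ)) = idealOfVars σ K := by
  apply le_antisymm
  · rw [faceIdeal, Ideal.span_le]
    rintro _ ⟨w, hw, rfl⟩
    obtain ⟨s, hs⟩ : w.support.Nonempty := by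
      rw [Finset.nonempty_iff_ne_empty]
      simpa using hw
    refine Ideal.mem_of_dvd _ ?_ (Ideal.subset_span ⟨s, rfl⟩)
    rw [X_dvd_monomial]
    exact Or.inr (Finsupp.mem_support_iff.1 hs)
  · rw [Ideal.span_le]
    rintro _ ⟨s, rfl⟩
    exact (X_mem_faceIdeal (isLowerSet_powerset _)).2 (by simp)

theorem faceIdeal_powerset_univ [Fintype σ] :
    faceIdeal K (Finset.powerset (Finset.univ : Finset σ)) = ⊥ := by
  simp [faceIdeal]

theorem faceIdeal_le_idealOfVars [Fintype σ] {Δ : Finset (Finset σ)} (h0 : ∅ ∈ Δ) :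
    faceIdeal K Δ ≤ idealOfVars σ K := by
  rw [← faceIdeal_singleton_empty]
  exact faceIdeal_mono (by simpa using h0)

/-- Elements with nonzero constant term act as units of the local ring at the origin would: every
prime that arises lies inside the ideal of the variables. -/
theorem regular_of_notMem_idealOfVars [Fintype σ] {h : MvPolynomial σ K}
    (hh : h ∉ idealOfVars σ K) {Δ : Finset (Finset σ)} (hΔ : IsLowerSet (Δ : Set (Finset σ)))
    (h0 : ∅ ∈ Δ) : ∀ z, h * z ∈ faceIdeal K Δ → z ∈ faceIdeal K Δ := by
  refine complex_induction (C := fun Δ => ∅ ∈ Δ)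
    (P := fun Δ => ∀ z, h * z ∈ faceIdeal K Δ → z ∈ faceIdeal K Δ) (fun _ h => h)
    (fun Δ hΔ h0 b hb _ => ⟨(mem_star_iff hΔ).2 (by simpa using hb), mem_del_iff.2 (by simpa)⟩)
    (fun W _ z hz => ?_) (fun Δ hΔ b _ => regular_step hΔ b) Δ hΔ h0
  exact ((faceIdeal_powerset_isPrime W).mem_or_mem hz).resolve_left fun h =>
    hh (faceIdeal_le_idealOfVars (by simp) h)

theorem sum_X_notMem_faceIdeal [Fintype σ] {Δ : Finset (Finset σ)}
    (hΔ : IsLowerSet (Δ : Set (Finset σ))) {v : σ} (h : {v} ∈ Δ) :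
    (∑ s, X s : MvPolynomial σ K) ∉ faceIdeal K Δ := by
  rw [mem_faceIdeal hΔ]
  push Not
  refine ⟨Finsupp.single v 1, ?_, by simpa using h⟩
  simp [coeff_sum, coeff_X, Finsupp.single_left_inj]

theorem regular_of_notMem [Fintype σ] {f : MvPolynomial σ K}
    (hf : ∀ (W : Finset σ) (v : σ), v ∈ W → f ∉ faceIdeal K W.powerset)
    {Δ : Finset (Finset σ)} (hΔ : IsLowerSet (Δ : Set (Finset σ))) (h : ∃ v, {v} ∈ Δ) :
    ∀ z, f * z ∈ faceIdeal K Δ → z ∈ faceIdeal K Δ := by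
  refine complex_induction (C := fun Δ => IsLowerSet (Δ : Set (Finset σ)) ∧ ∃ v, {v} ∈ Δ)
    (P := fun Δ => ∀ z, f * z ∈ faceIdeal K Δ → z ∈ faceIdeal K Δ)
    (fun Δ h => empty_mem h.1 h.2.choose_spec)
    (fun Δ hΔ h b hb hne => ⟨⟨isLowerSet_star hΔ b, b, singleton_mem_star hΔ hb⟩,
      isLowerSet_del hΔ b, exists_vertex_del hΔ hb hne⟩)
    (fun W h z hz => ?_) (fun Δ hΔ b _ => regular_step hΔ b) Δ hΔ ⟨hΔ, h⟩
  obtain ⟨v, hv⟩ := h.2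
  exact ((faceIdeal_powerset_isPrime W).mem_or_mem hz).resolve_left (hf W v (by simpa using hv))

theorem regular_sum_X [Fintype σ] {Δ : Finset (Finset σ)} (hΔ : IsLowerSet (Δ : Set (Finset σ)))
    (h : ∃ v, {v} ∈ Δ) (z : MvPolynomial σ K) (hz : (∑ s, X s) * z ∈ faceIdeal K Δ) :
    z ∈ faceIdeal K Δ :=
  regular_of_notMem (fun W v hv => sum_X_notMem_faceIdeal (isLowerSet_powerset W) (v := v)
    (by simpa using hv)) hΔ h z hz

/-- On a simplex with two vertices the ideal plus (∑ x_s) is prime and misses a variable, so nothing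
outside it is killed by all variables. `socle_step` extends this to cones. -/
theorem socle_of_isCone [Fintype σ] {Δ : Finset (Finset σ)} (hΔ : IsLowerSet (Δ : Set (Finset σ)))
    (h : IsCone Δ) (z : MvPolynomial σ K)
    (hz : ∀ s, X s * z ∈ faceIdeal K Δ ⊔ Ideal.span {∑ s, X s}) :
    z ∈ faceIdeal K Δ ⊔ Ideal.span {∑ s, X s} := by
  have hreg := fun Δ hΔ h => regular_sum_X (K := K) (σ := σ) (Δ := Δ) hΔ h
  have hprime := fun W c d => exists_isPrime_sum_X (K := K) (σ := σ) (W := W) (c := c) (d := d)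
  generalize (∑ s, X s : MvPolynomial σ K) = f at *
  refine complex_induction (C := fun Δ => IsLowerSet (Δ : Set (Finset σ)) ∧ IsCone Δ)
    (P := fun Δ => ∀ z : MvPolynomial σ K,
      (∀ s, X s * z ∈ faceIdeal K Δ ⊔ Ideal.span {f}) → z ∈ faceIdeal K Δ ⊔ Ideal.span {f})
    (fun Δ h => empty_mem h.1 h.2.exists_vertex.choose_spec)
    (fun Δ hΔ h b hb hne => ⟨⟨isLowerSet_star hΔ b, (h.2.star_del hΔ hb hne).1⟩,
      isLowerSet_del hΔ b, (h.2.star_del hΔ hb hne).2⟩)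
    (fun W h z hz => ?_)
    (fun Δ hΔ b h => socle_step hΔ b (hreg _ h.1 h.2.exists_vertex)) Δ hΔ ⟨hΔ, h⟩ z hz
  obtain ⟨c, v, hcv, hv, hc⟩ := h.2
  have hcW : c ∈ W := by
    have : ∅ ∈ star W.powerset c := by rw [hc]; simp
    simpa [mem_star_iff h.1] using this
  obtain ⟨h1, h2⟩ := hprime W c v hcW (by simpa using hv : v ∈ W) hcv
  exact (h1.mem_or_mem (hz v)).resolve_left h2

end FaceIdeal

end

/-! ### Projective dimension along short exact sequences. -/

noncomputable section

namespace FaceIdeal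

open MvPolynomial CategoryTheory

universe u

section Colon

variable {R : Type u} [CommRing R] {A B C : Ideal R} {x : R}

/-- Multiplication by `x`, as a map `R ⧸ A → R ⧸ B`. -/
def mulMap (x : R) (h : ∀ p ∈ A, x * p ∈ B) : (R ⧸ A) →ₗ[R] (R ⧸ B) :=
  Submodule.mapQ A B (LinearMap.lsmul R R x) h

theorem mulMap_mk (h : ∀ p ∈ A, x * p ∈ B) (p : R) :
    mulMap x h (Ideal.Quotient.mk A p) = Ideal.Quotient.mk B (x * p) := rfl

/-- The projection `R ⧸ B → R ⧸ C` for `B ≤ C`. -/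
def projMap (h : B ≤ C) : (R ⧸ B) →ₗ[R] (R ⧸ C) := Submodule.mapQ B C LinearMap.id h

theorem projMap_mk (h : B ≤ C) (p : R) :
    projMap h (Ideal.Quotient.mk B p) = Ideal.Quotient.mk C p := rfl

theorem projMap_surjective (h : B ≤ C) : Function.Surjective (projMap h) := fun y => by
  obtain ⟨y, rfl⟩ := Ideal.Quotient.mk_surjective y
  exact ⟨_, projMap_mk h y⟩

theorem mulMap_injective (hA : ∀ p, p ∈ A ↔ x * p ∈ B) :
    Function.Injective (mulMap x fun p => (hA p).1) := by
  refine (injective_iff_map_eq_zero _).2 fun y hy => ?_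
  obtain ⟨y, rfl⟩ := Ideal.Quotient.mk_surjective y
  rw [mulMap_mk, Ideal.Quotient.eq_zero_iff_mem, ← hA] at hy
  exact Ideal.Quotient.eq_zero_iff_mem.2 hy

theorem exact_mulMap_projMap (h : ∀ p ∈ A, x * p ∈ B) (hC : C = B ⊔ Ideal.span {x}) :
    Function.Exact (mulMap x h) (projMap (hC ▸ le_sup_left : B ≤ C)) := by
  intro y
  obtain ⟨y, rfl⟩ := Ideal.Quotient.mk_surjective y
  rw [projMap_mk, Ideal.Quotient.eq_zero_iff_mem, hC, mem_sup_span_singleton]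
  constructor
  · rintro ⟨q, hq, r, rfl⟩
    refine ⟨Ideal.Quotient.mk A r, ?_⟩
    rw [mulMap_mk, Ideal.Quotient.eq, sub_add_cancel_right]
    exact neg_mem hq
  · rintro ⟨r, hr⟩
    obtain ⟨r, rfl⟩ := Ideal.Quotient.mk_surjective r
    rw [mulMap_mk, eq_comm, Ideal.Quotient.eq] at hr
    exact ⟨_, hr, r, by ring⟩

/-- The complex `R ⧸ (B : x) ⟶ R ⧸ B ⟶ R ⧸ (B + (x))`, the first map being multiplication
by `x`. -/
abbrev colonComplex (h : ∀ p ∈ A, x * p ∈ B) (hC : C = B ⊔ Ideal.span {x}) :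
    ShortComplex (ModuleCat.{u} R) :=
  ModuleCat.shortComplexOfCompEqZero (mulMap x h) (projMap (hC ▸ le_sup_left : B ≤ C))
    (exact_mulMap_projMap h hC).linearMap_comp_eq_zero

theorem colonComplex_shortExact (hA : ∀ p, p ∈ A ↔ x * p ∈ B) (hC : C = B ⊔ Ideal.span {x}) :
    (colonComplex (fun p => (hA p).1) hC).ShortExact :=
  ModuleCat.shortComplex_shortExact _ (exact_mulMap_projMap (fun p => (hA p).1) hC)
    (mulMap_injective hA) (projMap_surjective (hC ▸ le_sup_left : B ≤ C))

theorem hasProjectiveDimensionLT_of_colon (hA : ∀ p, p ∈ A ↔ x * p ∈ B)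
    (hC : C = B ⊔ Ideal.span {x}) {d : ℕ}
    (h1 : HasProjectiveDimensionLT (ModuleCat.of R (R ⧸ A)) d)
    (h2 : HasProjectiveDimensionLT (ModuleCat.of R (R ⧸ C)) d) :
    HasProjectiveDimensionLT (ModuleCat.of R (R ⧸ B)) d :=
  (colonComplex_shortExact hA hC).hasProjectiveDimensionLT_X₂ d h1 h2

theorem hasProjectiveDimensionLT_succ_of_regular (hA : ∀ p, p ∈ B ↔ x * p ∈ B)
    (hC : C = B ⊔ Ideal.span {x}) {d : ℕ}
    (h : HasProjectiveDimensionLT (ModuleCat.of R (R ⧸ B)) d) :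
    HasProjectiveDimensionLT (ModuleCat.of R (R ⧸ C)) (d + 1) :=
  (colonComplex_shortExact hA hC).hasProjectiveDimensionLT_X₃ d h
    (hasProjectiveDimensionLT_of_ge _ d _ (Nat.le_succ d))

-- In the long exact sequence the connecting map Ext^d(R/B, Y) → Ext^{d+1}(R/C, Y) has as kernel the
-- image of multiplication by `x`, which vanishes because `x` kills `Y`.
open Abelian in
theorem exists_ext_ne_zero_of_regular (hA : ∀ p, p ∈ B ↔ x * p ∈ B)
    (hC : C = B ⊔ Ideal.span {x}) {Y : ModuleCat.{u} R} (hY : ∀ y : Y, x • y = 0) {d : ℕ}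
    (h : ∃ e : Ext (ModuleCat.of R (R ⧸ B)) Y d, e ≠ 0) :
    ∃ e : Ext (ModuleCat.of R (R ⧸ C)) Y (d + 1), e ≠ 0 := by
  obtain ⟨e, he⟩ := h
  have hS := colonComplex_shortExact hA hC
  refine ⟨hS.extClass.comp e (add_comm 1 d), fun h0 => he ?_⟩
  obtain ⟨e', rfl⟩ := Ext.contravariant_sequence_exact₁ hS Y e (add_comm 1 d) h0
  have hf : (colonComplex (fun p => (hA p).1) hC).f = x • 𝟙 (ModuleCat.of R (R ⧸ B)) := by
    ext
    rfl
  have hY' : x • 𝟙 Y = 0 := by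
    ext y
    exact hY y
  rw [hf, Ext.mk₀_smul, Ext.smul_comp, Ext.mk₀_id_comp, Ext.smul_eq_comp_mk₀, hY', Ext.mk₀_zero,
    Ext.comp_zero]

/-- Mayer–Vietoris: 0 → R/(A ∩ B) → R/A × R/B → R/(A + B) → 0. -/
theorem hasProjectiveDimensionLT_of_inf_sup {d : ℕ}
    (hinf : HasProjectiveDimensionLT (ModuleCat.of R (R ⧸ (A ⊓ B))) d)
    (hA : HasProjectiveDimensionLT (ModuleCat.of R (R ⧸ A)) (d + 1))
    (hB : HasProjectiveDimensionLT (ModuleCat.of R (R ⧸ B)) (d + 1)) :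
    HasProjectiveDimensionLT (ModuleCat.of R (R ⧸ (A ⊔ B))) (d + 1) := by
  let f : (R ⧸ (A ⊓ B)) →ₗ[R] (R ⧸ A) × (R ⧸ B) :=
    (projMap inf_le_left).prod (projMap inf_le_right)
  let g : (R ⧸ A) × (R ⧸ B) →ₗ[R] (R ⧸ (A ⊔ B)) :=
    (projMap le_sup_left).coprod (-projMap le_sup_right)
  have hf_mk (p : R) : f (Ideal.Quotient.mk _ p) =
      (Ideal.Quotient.mk A p, Ideal.Quotient.mk B p) := rfl
  have hf : Function.Injective f := by
    refine (injective_iff_map_eq_zero _).2 fun y hy => ?_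
    obtain ⟨y, rfl⟩ := Ideal.Quotient.mk_surjective y
    rw [hf_mk, Prod.mk_eq_zero, Ideal.Quotient.eq_zero_iff_mem,
      Ideal.Quotient.eq_zero_iff_mem] at hy
    exact Ideal.Quotient.eq_zero_iff_mem.2 hy
  have hg : Function.Surjective g := fun y => by
    obtain ⟨z, rfl⟩ := projMap_surjective le_sup_left y
    exact ⟨(z, 0), by simp [g]⟩
  have hfg : Function.Exact f g := by
    rintro ⟨y, z⟩
    obtain ⟨y, rfl⟩ := Ideal.Quotient.mk_surjective y
    obtain ⟨z, rfl⟩ := Ideal.Quotient.mk_surjective z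
    simp only [g, LinearMap.coprod_apply, LinearMap.neg_apply, projMap_mk, ← sub_eq_add_neg,
      sub_eq_zero, Ideal.Quotient.eq]
    constructor
    · intro h
      obtain ⟨a, ha, b, hb, hab⟩ := Submodule.mem_sup.1 h
      refine ⟨Ideal.Quotient.mk _ (y - a), ?_⟩
      rw [hf_mk, Prod.mk.injEq, Ideal.Quotient.eq, Ideal.Quotient.eq]
      constructor
      · simpa using ha
      · rw [show y - a - z = b by linear_combination -hab]
        exact hb
    · rintro ⟨w, hw⟩
      obtain ⟨w, rfl⟩ := Ideal.Quotient.mk_surjective w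
      rw [hf_mk, Prod.mk.injEq, Ideal.Quotient.eq, Ideal.Quotient.eq] at hw
      rw [show y - z = -(w - y) + (w - z) by ring]
      exact Submodule.add_mem_sup (neg_mem hw.1) hw.2
  have hprod : HasProjectiveDimensionLT (ModuleCat.of R ((R ⧸ A) × (R ⧸ B))) (d + 1) :=
    (ModuleCat.shortComplex_shortExact (ModuleCat.shortComplexOfCompEqZero
      (LinearMap.inl R (R ⧸ A) (R ⧸ B)) (LinearMap.snd R (R ⧸ A) (R ⧸ B))
      (Function.Exact.inl_snd).linearMap_comp_eq_zero) Function.Exact.inl_snd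
      LinearMap.inl_injective LinearMap.snd_surjective).hasProjectiveDimensionLT_X₂ (d + 1) hA hB
  exact (ModuleCat.shortComplex_shortExact (ModuleCat.shortComplexOfCompEqZero f g
    hfg.linearMap_comp_eq_zero) hfg hf hg).hasProjectiveDimensionLT_X₃ d hinf hprod

end Colon

variable {σ : Type} [Fintype σ] [DecidableEq σ] {K : Type u} [Field K]

theorem star_powerset {W : Finset σ} {a : σ} (ha : a ∈ W) : star W.powerset a = W.powerset :=
  Finset.filter_true_of_mem fun F hF => by
    rw [Finset.mem_powerset] at hF ⊢
    exact Finset.insert_subset ha hF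

theorem del_powerset (W : Finset σ) (a : σ) : del W.powerset a = (W.erase a).powerset := by
  ext F
  simp [mem_del_iff, Finset.subset_erase]

theorem mem_faceIdeal_powerset_iff_X_mul_mem {W : Finset σ} {a : σ} (ha : a ∈ W)
    (p : MvPolynomial σ K) :
    p ∈ faceIdeal K W.powerset ↔ X a * p ∈ faceIdeal K W.powerset := by
  rw [X_mul_mem_faceIdeal (isLowerSet_powerset W), star_powerset ha]

theorem faceIdeal_powerset_compl_insert {T : Finset σ} (a : σ) :
    faceIdeal K (insert a T)ᶜ.powerset = faceIdeal K Tᶜ.powerset ⊔ Ideal.span {X a} := by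
  rw [← faceIdeal_del, del_powerset, Finset.compl_insert]

variable (K)

theorem hasProjectiveDimensionLT_powerset (T : Finset σ) :
    HasProjectiveDimensionLT (ModuleCat.of (MvPolynomial σ K)
      (MvPolynomial σ K ⧸ faceIdeal K Tᶜ.powerset)) (T.card + 1) := by
  induction T using Finset.induction_on with
  | empty =>
    rw [Finset.compl_empty, faceIdeal_powerset_univ]
    exact hasProjectiveDimensionLT_of_iso
      (Submodule.quotEquivOfEqBot (⊥ : Ideal (MvPolynomial σ K)) rfl).symm.toModuleIso 1
  | insert a T ha ih =>
    rw [Finset.card_insert_of_notMem ha]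
    exact hasProjectiveDimensionLT_succ_of_regular
      (mem_faceIdeal_powerset_iff_X_mul_mem (by simpa using ha))
      (faceIdeal_powerset_compl_insert a) ih

-- Starts from the projection onto the residue field in degree 0; each further variable is regular
-- and raises the degree by one. With `T` everything, this bounds the projective dimension of the
-- residue field below.
open Abelian in
theorem exists_ext_powerset_ne_zero (T : Finset σ) :
    ∃ e : Ext (ModuleCat.of (MvPolynomial σ K) (MvPolynomial σ K ⧸ faceIdeal K Tᶜ.powerset))
      (ModuleCat.of (MvPolynomial σ K) (MvPolynomial σ K ⧸ idealOfVars σ K)) T.card, e ≠ 0 := by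
  induction T using Finset.induction_on with
  | empty =>
    have hle : faceIdeal K (∅ : Finset σ)ᶜ.powerset ≤ idealOfVars σ K :=
      faceIdeal_le_idealOfVars (by simp)
    refine ⟨Ext.mk₀ (ModuleCat.ofHom (projMap hle)), fun h => ?_⟩
    replace h := (Ext.mk₀_eq_zero_iff _).1 h
    have h1 : Ideal.Quotient.mk (idealOfVars σ K) 1 = 0 := by
      rw [← projMap_mk hle]
      exact congrArg (fun f => f.hom (Ideal.Quotient.mk _ 1)) h
    rw [Ideal.Quotient.eq_zero_iff_mem, ← Ideal.eq_top_iff_one, ← faceIdeal_singleton_empty] at h1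
    exact (faceIdeal_powerset_isPrime (∅ : Finset σ)).ne_top h1
  | insert a T ha ih =>
    rw [Finset.card_insert_of_notMem ha]
    refine exists_ext_ne_zero_of_regular
      (mem_faceIdeal_powerset_iff_X_mul_mem (by simpa using ha))
      (faceIdeal_powerset_compl_insert a) (fun y => ?_) ih
    obtain ⟨y, rfl⟩ := Ideal.Quotient.mk_surjective y
    exact Ideal.Quotient.eq_zero_iff_mem.2
      (Ideal.mul_mem_right _ _ (Ideal.subset_span ⟨a, rfl⟩))

theorem not_hasProjectiveDimensionLT_idealOfVars :
    ¬ HasProjectiveDimensionLT (ModuleCat.of (MvPolynomial σ K)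
      (MvPolynomial σ K ⧸ idealOfVars σ K)) (Fintype.card σ) := by
  have key (T : Finset σ) : ¬ HasProjectiveDimensionLT (ModuleCat.of (MvPolynomial σ K)
      (MvPolynomial σ K ⧸ faceIdeal K Tᶜ.powerset)) T.card := fun h => by
    obtain ⟨e, he⟩ := exists_ext_powerset_ne_zero K T
    exact he (e.eq_zero_of_hasProjectiveDimensionLT T.card le_rfl)
  have := key Finset.univ
  rwa [Finset.compl_univ, faceIdeal_singleton_empty] at this

variable {K}

theorem hasProjectiveDimensionLT_step {Δ : Finset (Finset σ)}
    (hΔ : IsLowerSet (Δ : Set (Finset σ))) (b : σ) {d : ℕ}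
    (h1 : HasProjectiveDimensionLT (ModuleCat.of (MvPolynomial σ K)
      (MvPolynomial σ K ⧸ faceIdeal K (star Δ b))) d)
    (h2 : HasProjectiveDimensionLT (ModuleCat.of (MvPolynomial σ K)
      (MvPolynomial σ K ⧸ faceIdeal K (del Δ b))) d) :
    HasProjectiveDimensionLT (ModuleCat.of (MvPolynomial σ K)
      (MvPolynomial σ K ⧸ faceIdeal K Δ)) d :=
  hasProjectiveDimensionLT_of_colon (fun _ => (X_mul_mem_faceIdeal hΔ b).symm)
    (faceIdeal_del Δ b) h1 h2

theorem hasProjectiveDimensionLT_powerset_of_le (W : Finset σ) {d : ℕ}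
    (h : Fintype.card σ + 1 ≤ W.card + d) :
    HasProjectiveDimensionLT (ModuleCat.of (MvPolynomial σ K)
      (MvPolynomial σ K ⧸ faceIdeal K W.powerset)) d := by
  have := hasProjectiveDimensionLT_powerset K Wᶜ
  rw [compl_compl] at this
  refine hasProjectiveDimensionLT_of_ge _ (Wᶜ.card + 1) d ?_
  rw [Finset.card_compl]
  have := Finset.card_le_univ W
  omega

theorem hasProjectiveDimensionLT_of_vertex {Δ : Finset (Finset σ)}
    (hΔ : IsLowerSet (Δ : Set (Finset σ))) (h : ∃ v, {v} ∈ Δ) :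
    HasProjectiveDimensionLT (ModuleCat.of (MvPolynomial σ K)
      (MvPolynomial σ K ⧸ faceIdeal K Δ)) (Fintype.card σ) := by
  refine complex_induction (C := fun Δ => IsLowerSet (Δ : Set (Finset σ)) ∧ ∃ v, {v} ∈ Δ)
    (P := fun Δ => HasProjectiveDimensionLT (ModuleCat.of (MvPolynomial σ K)
      (MvPolynomial σ K ⧸ faceIdeal K Δ)) (Fintype.card σ))
    (fun Δ h => empty_mem h.1 h.2.choose_spec)
    (fun Δ hΔ h b hb hne => ⟨⟨isLowerSet_star hΔ b, b, singleton_mem_star hΔ hb⟩,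
      isLowerSet_del hΔ b, exists_vertex_del hΔ hb hne⟩)
    (fun W h => ?_) (fun Δ hΔ b _ => hasProjectiveDimensionLT_step hΔ b) Δ hΔ ⟨hΔ, h⟩
  obtain ⟨v, hv⟩ := h.2
  refine hasProjectiveDimensionLT_powerset_of_le W ?_
  have : 0 < W.card := Finset.card_pos.2 ⟨v, by simpa using hv⟩
  omega

theorem hasProjectiveDimensionLT_of_isCone {Δ : Finset (Finset σ)}
    (hΔ : IsLowerSet (Δ : Set (Finset σ))) (h : IsCone Δ) :
    HasProjectiveDimensionLT (ModuleCat.of (MvPolynomial σ K)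
      (MvPolynomial σ K ⧸ faceIdeal K Δ)) (Fintype.card σ - 1) := by
  refine complex_induction (C := fun Δ => IsLowerSet (Δ : Set (Finset σ)) ∧ IsCone Δ)
    (P := fun Δ => HasProjectiveDimensionLT (ModuleCat.of (MvPolynomial σ K)
      (MvPolynomial σ K ⧸ faceIdeal K Δ)) (Fintype.card σ - 1))
    (fun Δ h => empty_mem h.1 h.2.exists_vertex.choose_spec)
    (fun Δ hΔ h b hb hne => ⟨⟨isLowerSet_star hΔ b, (h.2.star_del hΔ hb hne).1⟩,
      isLowerSet_del hΔ b, (h.2.star_del hΔ hb hne).2⟩)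
    (fun W h => ?_)
    (fun Δ hΔ b _ => hasProjectiveDimensionLT_step hΔ b) Δ hΔ ⟨hΔ, h⟩
  obtain ⟨c, v, hcv, hv, hc⟩ := h.2
  have hcW : c ∈ W := by
    have : ∅ ∈ star W.powerset c := by rw [hc]; simp
    simpa [mem_star_iff h.1] using this
  refine hasProjectiveDimensionLT_powerset_of_le W ?_
  have : 1 < W.card := Finset.one_lt_card.2 ⟨c, hcW, v, by simpa using hv, hcv⟩
  omega

end FaceIdeal

end

/-! ### Depth at most one and depth at least two. -/

noncomputable section

namespace LexsegmentEdge

section Depth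

variable {R : Type*} [CommRing R]

theorem isSMulRegular_quotient_iff {I : Ideal R} {f : R} :
    IsSMulRegular (R ⧸ I) f ↔ ∀ z, f * z ∈ I → z ∈ I := by
  rw [isSMulRegular_iff_right_eq_zero_of_smul]
  constructor
  · intro h z hz
    exact Ideal.Quotient.eq_zero_iff_mem.1
      (h (Ideal.Quotient.mk I z) (Ideal.Quotient.eq_zero_iff_mem.2 hz))
  · intro h z hz
    obtain ⟨z, rfl⟩ := Ideal.Quotient.mk_surjective z
    exact Ideal.Quotient.eq_zero_iff_mem.2 (h z (Ideal.Quotient.eq_zero_iff_mem.1 hz))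

theorem quotSMulTop_mk_eq_zero_iff {I : Ideal R} {f z : R} :
    (Submodule.Quotient.mk (Ideal.Quotient.mk I z) : QuotSMulTop f (R ⧸ I)) = 0 ↔
      z ∈ I ⊔ Ideal.span {f} := by
  rw [Submodule.Quotient.mk_eq_zero, Submodule.mem_smul_pointwise_iff_exists,
    FaceIdeal.mem_sup_span_singleton]
  constructor
  · rintro ⟨w, -, hw⟩
    obtain ⟨w, rfl⟩ := Ideal.Quotient.mk_surjective w
    replace hw : Ideal.Quotient.mk I (f * w) = Ideal.Quotient.mk I z := hw
    exact ⟨z - f * w, Ideal.Quotient.eq.1 hw.symm, w, by ring⟩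
  · rintro ⟨q, hq, r, rfl⟩
    refine ⟨Ideal.Quotient.mk I r, trivial, ?_⟩
    change Ideal.Quotient.mk I (f * r) = _
    rw [Ideal.Quotient.eq, sub_add_cancel_right]
    exact neg_mem hq

theorem top_ne_ofList_smul {I J : Ideal R} (hIJ : I ≤ J) (hJ : J ≠ ⊤) {rs : List R}
    (hrs : ∀ r ∈ rs, r ∈ J) :
    (⊤ : Submodule R (R ⧸ I)) ≠ Ideal.ofList rs • (⊤ : Submodule R (R ⧸ I)) := by
  intro h
  have h1 : Ideal.ofList rs • (⊤ : Submodule R (R ⧸ I)) ≤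
      LinearMap.ker (FaceIdeal.projMap hIJ) := by
    refine Submodule.smul_le.2 fun r hr n _ => ?_
    have hrJ : r ∈ J := Ideal.span_le.2 hrs hr
    obtain ⟨n, rfl⟩ := Ideal.Quotient.mk_surjective n
    exact Ideal.Quotient.eq_zero_iff_mem.2 (J.mul_mem_right n hrJ)
  have h2 : Ideal.Quotient.mk I 1 ∈ LinearMap.ker (FaceIdeal.projMap hIJ) :=
    h1 (h ▸ Submodule.mem_top)
  rw [LinearMap.mem_ker, FaceIdeal.projMap_mk, Ideal.Quotient.eq_zero_iff_mem] at h2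
  exact hJ ((Ideal.eq_top_iff_one J).2 h2)

theorem length_le_depth {J : Ideal R} {M : Type*} [AddCommGroup M] [Module R M] {rs : List R}
    (hJ : ∀ r ∈ rs, r ∈ J) (h : RingTheory.Sequence.IsRegular M rs) :
    (rs.length : ℕ∞) ≤ depth J M :=
  le_iSup₂_of_le rs ⟨hJ, h⟩ le_rfl

theorem one_le_depth {I J : Ideal R} (hIJ : I ≤ J) (hJ : J ≠ ⊤) {f : R} (hf : f ∈ J)
    (hreg : ∀ z, f * z ∈ I → z ∈ I) : 1 ≤ depth J (R ⧸ I) := by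
  have hrs : ∀ r ∈ [f], r ∈ J := by simpa using hf
  exact length_le_depth hrs ⟨(RingTheory.Sequence.isWeaklyRegular_singleton_iff _ f).2
    (isSMulRegular_quotient_iff.2 hreg), top_ne_ofList_smul hIJ hJ hrs⟩

/-- A nonzero socle element modulo `f` is killed by any candidate for the second term of a regular
sequence. -/
theorem depth_le_one {I J : Ideal R} (h : ∀ f ∈ J, (∀ z, f * z ∈ I → z ∈ I) →
      ∃ p ∉ I ⊔ Ideal.span {f}, ∀ g ∈ J, g * p ∈ I ⊔ Ideal.span {f}) :
    depth J (R ⧸ I) ≤ 1 := by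
  refine iSup₂_le fun rs hrs => ?_
  obtain ⟨hJ, hreg⟩ := hrs
  match rs with
  | [] => simp
  | [f] => simp
  | f :: g :: rs =>
    rw [RingTheory.Sequence.isRegular_cons_iff, RingTheory.Sequence.isRegular_cons_iff] at hreg
    obtain ⟨p, hp, hpg⟩ := h f (hJ f (by simp)) (isSMulRegular_quotient_iff.1 hreg.1)
    have hz := isSMulRegular_iff_right_eq_zero_of_smul.1 hreg.2.1
      (Submodule.Quotient.mk (Ideal.Quotient.mk I p))
      (quotSMulTop_mk_eq_zero_iff.2 (hpg g (hJ g (by simp))))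
    exact absurd (quotSMulTop_mk_eq_zero_iff.1 hz) hp

/-- Prime avoidance: otherwise `J` lies in an associated prime, the annihilator of some nonzero
element. The field may be finite. -/
theorem exists_isSMulRegular_mem [IsNoetherianRing R] {M : Type*} [AddCommGroup M] [Module R M]
    [Module.Finite R M] {J : Ideal R}
    (h : ∀ z : M, (∀ r ∈ J, r • z = 0) → z = 0) : ∃ g ∈ J, IsSMulRegular M g := by
  by_contra! hcon
  obtain ⟨P, hP, hJP⟩ : ∃ P ∈ associatedPrimes R M, J ≤ P := by
    refine (J.subset_union_prime_finite (associatedPrimes.finite R M) (f := id) 0 0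
      fun _ h _ _ ↦ h.1).1 ?_
    change (J : Set R) ⊆ ⋃ p ∈ associatedPrimes R M, (p : Set R)
    rw [biUnion_associatedPrimes_eq_zero_divisors]
    intro r hr
    have := hcon r hr
    rw [isSMulRegular_iff_right_eq_zero_of_smul] at this
    push Not at this
    obtain ⟨x, hx, hx0⟩ := this
    exact ⟨x, hx0, hx⟩
  rw [AssociatedPrimes.mem_iff, isAssociatedPrime_iff] at hP
  obtain ⟨prime, x, rfl⟩ := hP
  have hx : x = 0 := h x fun r hr => by
    simpa [Submodule.mem_colon_singleton] using hJP hr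
  exact prime.ne_top (by simp [hx])

theorem two_le_depth [IsNoetherianRing R] {I J : Ideal R} (hIJ : I ≤ J) (hJ : J ≠ ⊤)
    {f : R} (hf : f ∈ J) (hreg : ∀ z, f * z ∈ I → z ∈ I)
    (hsoc : ∀ z, (∀ r ∈ J, r * z ∈ I ⊔ Ideal.span {f}) → z ∈ I ⊔ Ideal.span {f}) :
    2 ≤ depth J (R ⧸ I) := by
  obtain ⟨g, hg, hgreg⟩ := exists_isSMulRegular_mem (M := QuotSMulTop f (R ⧸ I)) (J := J) (by
    intro z hz
    obtain ⟨z, rfl⟩ := Submodule.Quotient.mk_surjective _ z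
    obtain ⟨z, rfl⟩ := Ideal.Quotient.mk_surjective z
    exact quotSMulTop_mk_eq_zero_iff.2
      (hsoc z fun r hr => quotSMulTop_mk_eq_zero_iff.1 (hz r hr)))
  have hrs : ∀ r ∈ [f, g], r ∈ J := by simp [hf, hg]
  refine length_le_depth (rs := [f, g]) hrs ⟨?_, top_ne_ofList_smul hIJ hJ hrs⟩
  rw [RingTheory.Sequence.isWeaklyRegular_cons_iff,
    RingTheory.Sequence.isWeaklyRegular_singleton_iff]
  exact ⟨isSMulRegular_quotient_iff.2 hreg, hgreg⟩

end Depth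

end LexsegmentEdge

/-! ### Connected and separated complexes. -/

namespace FaceIdeal

open MvPolynomial CategoryTheory

universe u

variable {σ : Type} [Fintype σ] [DecidableEq σ] {K : Type u} [Field K]

theorem idealOfVars_ne_top : idealOfVars σ K ≠ ⊤ := by
  rw [← faceIdeal_singleton_empty]
  exact (faceIdeal_powerset_isPrime (∅ : Finset σ)).ne_top

/-- The restriction of `Δ` to the vertex set `W`. -/
def restrict (Δ : Finset (Finset σ)) (W : Finset σ) : Finset (Finset σ) := Δ.filter (· ⊆ W)

theorem mem_restrict {Δ : Finset (Finset σ)} {W F : Finset σ} :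
    F ∈ restrict Δ W ↔ F ∈ Δ ∧ F ⊆ W := by
  simp [restrict]

theorem isLowerSet_restrict {Δ : Finset (Finset σ)} (hΔ : IsLowerSet (Δ : Set (Finset σ)))
    (W : Finset σ) : IsLowerSet (restrict Δ W : Set (Finset σ)) := by
  intro F G hGF hF
  rw [Finset.mem_coe, mem_restrict] at hF ⊢
  exact ⟨hΔ hGF hF.1, hGF.trans hF.2⟩

/-- `Δ` is a complex with at least two vertices in which no proper nonempty set of vertices is
separated from its complement. -/
def IsConnected (Δ : Finset (Finset σ)) : Prop :=
  (∃ a b, a ≠ b ∧ {a} ∈ Δ ∧ {b} ∈ Δ) ∧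
    ∀ W : Finset σ, ∀ a ∈ W, ∀ b ∉ W, {a} ∈ Δ → {b} ∈ Δ → ∃ c ∈ W, ∃ d ∉ W, {c, d} ∈ Δ

theorem isCone_pair {Δ : Finset (Finset σ)} (hΔ : IsLowerSet (Δ : Set (Finset σ))) {c d : σ}
    (hcd : c ≠ d) (h : {c, d} ∈ Δ) : IsCone (restrict Δ {c, d}) := by
  refine ⟨c, d, hcd, mem_restrict.2 ⟨hΔ (Finset.subset_insert _ _) h, by simp⟩, ?_⟩
  refine Finset.filter_true_of_mem fun F hF => ?_
  have := (mem_restrict.1 hF).2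
  have h2 : insert c F ⊆ {c, d} := Finset.insert_subset (by simp) this
  exact mem_restrict.2 ⟨hΔ h2 h, h2⟩

theorem isCone_star_pair {Δ : Finset (Finset σ)} (hΔ : IsLowerSet (Δ : Set (Finset σ))) {c d : σ}
    (hcd : c ≠ d) (h : {c, d} ∈ Δ) : IsCone (star Δ d) := by
  refine ⟨d, c, hcd.symm, (mem_star_iff hΔ).2 (by rwa [Finset.pair_comm]), ?_⟩
  refine Finset.filter_true_of_mem fun F hF => ?_
  rw [mem_star_iff hΔ] at hF ⊢
  simpa using hF

/-- Builds Δ from one edge by adding vertices adjacent to those already present. Deleting the new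
vertex returns the previous stage, and its star is a cone with two vertices. -/
theorem IsConnected.induction {Δ : Finset (Finset σ)} (hΔ : IsLowerSet (Δ : Set (Finset σ)))
    (hc : IsConnected Δ) {P : Finset (Finset σ) → Prop}
    (hcone : ∀ Γ : Finset (Finset σ), IsLowerSet (Γ : Set (Finset σ)) → IsCone Γ → P Γ)
    (step : ∀ Γ : Finset (Finset σ), IsLowerSet (Γ : Set (Finset σ)) → ∀ b,
      (∃ v, {v} ∈ del Γ b) → P (star Γ b) → P (del Γ b) → P Γ) : P Δ := by
  obtain ⟨⟨a, b, hab, ha, hb⟩, hsep⟩ := hc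
  obtain ⟨c, hc, d, hd, hcd⟩ := hsep {a} a (by simp) b (by simpa using hab.symm) ha hb
  have hne : c ≠ d := fun h => hd (h ▸ hc)
  -- The order of adding vertices stays implicit: a maximal good vertex set must contain every
  -- vertex, or an edge leaving it would enlarge it.
  let S : Set (Finset σ) := {W | c ∈ W ∧ P (restrict Δ W)}
  obtain ⟨W, hW⟩ := (Set.toFinite S).exists_maximal ⟨{c, d}, by simp, hcone _
    (isLowerSet_restrict hΔ _) (isCone_pair hΔ hne hcd)⟩
  obtain ⟨⟨hcW, hPW⟩, hmax⟩ := hW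
  have hall : ∀ b, {b} ∈ Δ → b ∈ W := by
    intro b hb
    by_contra hbW
    obtain ⟨x, hx, y, hy, hxy⟩ := hsep W c hcW b hbW
      (hΔ (by simp : ({c} : Finset σ) ⊆ {c, d}) hcd) hb
    have hxy' : x ≠ y := fun h => hy (h ▸ hx)
    have hlow := isLowerSet_restrict hΔ (insert y W)
    have hdel : del (restrict Δ (insert y W)) y = restrict Δ W := by
      ext F
      rw [mem_del_iff, mem_restrict, mem_restrict, and_assoc]
      refine and_congr_right fun _ => ⟨fun h => ?_, fun h => ⟨?_, fun hyF => hy (h hyF)⟩⟩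
      · exact (Finset.subset_insert_iff_of_notMem h.2).1 h.1
      · exact h.trans (Finset.subset_insert _ _)
    refine hy (hmax (y := insert y W) ⟨Finset.mem_insert_of_mem hcW, ?_⟩
      (Finset.subset_insert _ _) (Finset.mem_insert_self _ _))
    refine step _ hlow y ?_ (hcone _ (isLowerSet_star hlow y)
      (isCone_star_pair hlow hxy' (mem_restrict.2 ⟨hxy, ?_⟩))) (hdel ▸ hPW)
    · rw [hdel]
      exact ⟨x, mem_restrict.2 ⟨hΔ (by simp) hxy, by simpa using hx⟩⟩
    · exact Finset.insert_subset (by simp [hx]) (by simp)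
  have : restrict Δ W = Δ := Finset.filter_true_of_mem fun F hF x hx =>
    hall x (hΔ (by simpa using hx) hF)
  rwa [this] at hPW

theorem IsConnected.hasProjectiveDimensionLT {Δ : Finset (Finset σ)}
    (hΔ : IsLowerSet (Δ : Set (Finset σ))) (hc : IsConnected Δ) :
    HasProjectiveDimensionLT (ModuleCat.of (MvPolynomial σ K)
      (MvPolynomial σ K ⧸ faceIdeal K Δ)) (Fintype.card σ - 1) :=
  hc.induction hΔ (P := fun Δ => HasProjectiveDimensionLT (ModuleCat.of (MvPolynomial σ K)
      (MvPolynomial σ K ⧸ faceIdeal K Δ)) (Fintype.card σ - 1))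
    (fun _ hΓ h => hasProjectiveDimensionLT_of_isCone hΓ h)
    fun _ hΓ b _ => hasProjectiveDimensionLT_step hΓ b

theorem sum_X_mem_idealOfVars : (∑ s, X s : MvPolynomial σ K) ∈ idealOfVars σ K :=
  Ideal.sum_mem _ fun s _ => Ideal.subset_span ⟨s, rfl⟩

theorem IsConnected.two_le_depth {Δ : Finset (Finset σ)}
    (hΔ : IsLowerSet (Δ : Set (Finset σ))) (hc : IsConnected Δ) :
    2 ≤ LexsegmentEdge.depth (idealOfVars σ K) (MvPolynomial σ K ⧸ faceIdeal K Δ) := by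
  have hv : ∃ v, {v} ∈ Δ := ⟨_, hc.1.choose_spec.choose_spec.2.1⟩
  refine LexsegmentEdge.two_le_depth (faceIdeal_le_idealOfVars (empty_mem hΔ hv.choose_spec))
    idealOfVars_ne_top sum_X_mem_idealOfVars (regular_sum_X hΔ hv) fun z hz => ?_
  replace hz := fun s => hz (X s) (Ideal.subset_span ⟨s, rfl⟩)
  have hreg := fun Δ hΔ h => regular_sum_X (K := K) (σ := σ) (Δ := Δ) hΔ h
  have hcone := fun Δ hΔ h => socle_of_isCone (K := K) (σ := σ) (Δ := Δ) hΔ h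
  generalize (∑ s, X s : MvPolynomial σ K) = f at *
  exact hc.induction hΔ (P := fun Δ => ∀ z : MvPolynomial σ K,
      (∀ s, X s * z ∈ faceIdeal K Δ ⊔ Ideal.span {f}) → z ∈ faceIdeal K Δ ⊔ Ideal.span {f})
    hcone (fun Γ hΓ b hv => socle_step hΓ b (hreg _ (isLowerSet_del hΓ b) hv)) z hz

/-- `Δ` has vertices in `W` and outside `W`, and no face meets both `W` and its complement. -/
def IsSeparatedBy (Δ : Finset (Finset σ)) (W : Finset σ) : Prop :=
  (∃ a ∈ W, {a} ∈ Δ) ∧ (∃ b ∉ W, {b} ∈ Δ) ∧ ∀ F ∈ Δ, F ⊆ W ∨ F ⊆ Wᶜ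

theorem IsSeparatedBy.inf_eq {Δ : Finset (Finset σ)} {W : Finset σ}
    (hΔ : IsLowerSet (Δ : Set (Finset σ))) (h : IsSeparatedBy Δ W) :
    faceIdeal K (restrict Δ W) ⊓ faceIdeal K (restrict Δ Wᶜ) = faceIdeal K Δ := by
  ext p
  rw [Ideal.mem_inf, mem_faceIdeal hΔ, mem_faceIdeal (isLowerSet_restrict hΔ _),
    mem_faceIdeal (isLowerSet_restrict hΔ _), ← forall₂_and]
  refine forall₂_congr fun m _ => ?_
  have := h.2.2 m.support
  rw [mem_restrict, mem_restrict]
  tauto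

theorem IsSeparatedBy.sup_eq {Δ : Finset (Finset σ)} {W : Finset σ}
    (hΔ : IsLowerSet (Δ : Set (Finset σ))) (h : IsSeparatedBy Δ W) :
    faceIdeal K (restrict Δ W) ⊔ faceIdeal K (restrict Δ Wᶜ) = idealOfVars σ K := by
  have h0 : ∅ ∈ Δ := empty_mem hΔ h.1.choose_spec.2
  refine le_antisymm (sup_le (faceIdeal_le_idealOfVars (mem_restrict.2 ⟨h0, by simp⟩))
    (faceIdeal_le_idealOfVars (mem_restrict.2 ⟨h0, by simp⟩))) (Ideal.span_le.2 ?_)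
  rintro _ ⟨s, rfl⟩
  by_cases hs : s ∈ W
  · refine Ideal.mem_sup_right ((X_mem_faceIdeal (isLowerSet_restrict hΔ _)).2 ?_)
    simp [mem_restrict, hs]
  · refine Ideal.mem_sup_left ((X_mem_faceIdeal (isLowerSet_restrict hΔ _)).2 ?_)
    simp [mem_restrict, hs]

theorem IsSeparatedBy.exists_vertex {Δ : Finset (Finset σ)} {W : Finset σ}
    (h : IsSeparatedBy Δ W) :
    (∃ v, {v} ∈ restrict Δ W) ∧ ∃ v, {v} ∈ restrict Δ Wᶜ := by
  obtain ⟨⟨a, ha, ha'⟩, ⟨b, hb, hb'⟩, -⟩ := h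
  exact ⟨⟨a, mem_restrict.2 ⟨ha', by simpa using ha⟩⟩, b, mem_restrict.2 ⟨hb', by simpa using hb⟩⟩

/-- Mayer–Vietoris would otherwise give the residue field projective dimension below the number of
variables. -/
theorem IsSeparatedBy.not_hasProjectiveDimensionLT {Δ : Finset (Finset σ)} {W : Finset σ}
    (hΔ : IsLowerSet (Δ : Set (Finset σ))) (h : IsSeparatedBy Δ W) :
    ¬ HasProjectiveDimensionLT (ModuleCat.of (MvPolynomial σ K)
      (MvPolynomial σ K ⧸ faceIdeal K Δ)) (Fintype.card σ - 1) := by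
  intro hpd
  obtain ⟨a, -⟩ := h.1
  obtain ⟨d, hd⟩ : ∃ d, Fintype.card σ = d + 1 :=
    Nat.exists_eq_succ_of_ne_zero (Fintype.card_pos_iff.2 ⟨a⟩).ne'
  refine not_hasProjectiveDimensionLT_idealOfVars (σ := σ) K ?_
  have h1 := hasProjectiveDimensionLT_of_vertex (K := K) (isLowerSet_restrict hΔ W)
    h.exists_vertex.1
  have h2 := hasProjectiveDimensionLT_of_vertex (K := K) (isLowerSet_restrict hΔ Wᶜ)
    h.exists_vertex.2
  rw [hd] at h1 h2 hpd ⊢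
  rw [← h.inf_eq hΔ] at hpd
  rw [← h.sup_eq hΔ]
  exact hasProjectiveDimensionLT_of_inf_sup hpd h1 h2

/-- Write I = A ∩ B, A + B = m and f = p + q with p ∈ A, q ∈ B. Then p is a nonzero socle element
modulo I + (f). -/
theorem IsSeparatedBy.depth_eq_one {Δ : Finset (Finset σ)} {W : Finset σ}
    (hΔ : IsLowerSet (Δ : Set (Finset σ))) (h : IsSeparatedBy Δ W) :
    LexsegmentEdge.depth (idealOfVars σ K) (MvPolynomial σ K ⧸ faceIdeal K Δ) = 1 := by
  have hv : ∃ v, {v} ∈ Δ := ⟨_, h.1.choose_spec.2⟩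
  have h0 : ∅ ∈ Δ := empty_mem hΔ hv.choose_spec
  have hne := idealOfVars_ne_top (σ := σ) (K := K)
  refine le_antisymm (LexsegmentEdge.depth_le_one fun f hf hreg => ?_)
    (LexsegmentEdge.one_le_depth (faceIdeal_le_idealOfVars h0) hne
      sum_X_mem_idealOfVars (regular_sum_X hΔ hv))
  obtain ⟨⟨a, ha⟩, b, hb⟩ := h.exists_vertex
  have hlow1 := isLowerSet_restrict hΔ W
  have hlow2 := isLowerSet_restrict hΔ Wᶜ
  have hinf := h.inf_eq (K := K) hΔ
  have hreg1 (g : MvPolynomial σ K) (hg : g ∉ idealOfVars σ K) :=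
    regular_of_notMem_idealOfVars hg hlow1 (empty_mem hlow1 ha)
  have hreg2 (g : MvPolynomial σ K) (hg : g ∉ idealOfVars σ K) :=
    regular_of_notMem_idealOfVars hg hlow2 (empty_mem hlow2 hb)
  have ha1 := X_mem_faceIdeal (K := K) hlow1 (b := a)
  have ha2 := X_mem_faceIdeal (K := K) hlow2 (b := a)
  have hb1 := X_mem_faceIdeal (K := K) hlow1 (b := b)
  have hb2 := X_mem_faceIdeal (K := K) hlow2 (b := b)
  have haW : a ∈ W := by simpa using (mem_restrict.1 ha).2
  have hbW : b ∉ W := by simpa using (mem_restrict.1 hb).2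
  replace ha2 := ha2.2 (by simp [mem_restrict, haW])
  replace hb1 := hb1.2 (by simp [mem_restrict, hbW])
  rw [← h.sup_eq hΔ] at hf
  have hsup := h.sup_eq (K := K) hΔ
  obtain ⟨p, hp, q, hq, rfl⟩ := Submodule.mem_sup.1 hf
  refine ⟨p, fun hpf => ?_, fun g hg => ?_⟩
  · obtain ⟨i, hi, r, hr⟩ := mem_sup_span_singleton.1 hpf
    rw [← hinf] at hi
    -- In p = i + f r, either 1 - r or r lies outside m, hence is regular on S/B and S/A. So f lies
    -- in B or in A; a variable from the opposite ideal then multiplies f into I, contradicting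
    -- regularity of f.
    by_cases hrm : r ∈ idealOfVars σ K
    · have h1r : 1 - r ∉ idealOfVars σ K := fun h1 =>
        hne ((Ideal.eq_top_iff_one _).2 (by simpa using add_mem h1 hrm))
      have hf2 : p + q ∈ faceIdeal K (restrict Δ Wᶜ) := by
        refine hreg2 _ h1r _ ?_
        rw [show (1 - r) * (p + q) = q + i by linear_combination hr]
        exact add_mem hq hi.2
      refine (X_mem_faceIdeal (K := K) hlow2).1 ?_ hb
      refine (hinf.symm.le (hreg (X b) (hinf.le ⟨?_, ?_⟩))).2
      · exact Ideal.mul_mem_left _ _ hb1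
      · exact Ideal.mul_mem_right _ _ hf2
    · have hf1 : p + q ∈ faceIdeal K (restrict Δ W) := by
        refine hreg1 _ hrm _ ?_
        rw [show r * (p + q) = p - i by linear_combination -hr]
        exact sub_mem hp hi.1
      refine (X_mem_faceIdeal (K := K) hlow1).1 ?_ ha
      refine (hinf.symm.le (hreg (X a) (hinf.le ⟨?_, ?_⟩))).1
      · exact Ideal.mul_mem_right _ _ hf1
      · exact Ideal.mul_mem_left _ _ ha2
  · rw [← hsup] at hg
    obtain ⟨g1, hg1, g2, hg2, rfl⟩ := Submodule.mem_sup.1 hg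
    -- For g = g1 + g2 with g1 ∈ A and g2 ∈ B, g p = (g2 p - g1 q) + g1 f, and both products in the
    -- bracket lie in A ∩ B.
    refine mem_sup_span_singleton.2 ⟨g2 * p - g1 * q, hinf.le ⟨?_, ?_⟩, g1, by ring⟩
    · exact sub_mem (Ideal.mul_mem_left _ _ hp) (Ideal.mul_mem_right _ _ hg1)
    · exact sub_mem (Ideal.mul_mem_right _ _ hg2) (Ideal.mul_mem_left _ _ hq)

theorem IsSeparatedBy.projectiveDimension_eq {Δ : Finset (Finset σ)} {W : Finset σ}
    (hΔ : IsLowerSet (Δ : Set (Finset σ))) (h : IsSeparatedBy Δ W) :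
    projectiveDimension (ModuleCat.of (MvPolynomial σ K)
      (MvPolynomial σ K ⧸ faceIdeal K Δ)) = (Fintype.card σ - 1 : ℕ) := by
  have hv : ∃ v, {v} ∈ Δ := ⟨_, h.1.choose_spec.2⟩
  refine le_antisymm ?_ ((projectiveDimension_ge_iff _ _).2 (h.not_hasProjectiveDimensionLT hΔ))
  rw [projectiveDimension_le_iff]
  have := hasProjectiveDimensionLT_of_vertex (K := K) hΔ hv
  have hpos : 0 < Fintype.card σ := Fintype.card_pos_iff.2 ⟨hv.choose⟩
  have e : Fintype.card σ - 1 + 1 = Fintype.card σ := by omega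
  rwa [HasProjectiveDimensionLE, e]

theorem IsConnected.projectiveDimension_ne {Δ : Finset (Finset σ)}
    (hΔ : IsLowerSet (Δ : Set (Finset σ))) (h : IsConnected Δ) :
    projectiveDimension (ModuleCat.of (MvPolynomial σ K)
      (MvPolynomial σ K ⧸ faceIdeal K Δ)) ≠ (Fintype.card σ - 1 : ℕ) :=
  (projectiveDimension_lt_iff.2 (h.hasProjectiveDimensionLT hΔ)).ne

end FaceIdeal

end

/-! ### From lexsegments to complexes. -/

noncomputable section

namespace LexsegmentEdge

open MvPolynomial FaceIdeal

/-! ### The complex of a squarefree monomial ideal -/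

section Complex

variable {σ : Type} [Fintype σ] [DecidableEq σ]

open Classical in
/-- The sets containing the support of no exponent vector in `L`. -/
def complexOf (L : Set (σ →₀ ℕ)) : Finset (Finset σ) :=
  Finset.univ.filter fun F => ∀ w ∈ L, ¬ w.support ⊆ F

theorem mem_complexOf {L : Set (σ →₀ ℕ)} {F : Finset σ} :
    F ∈ complexOf L ↔ ∀ w ∈ L, ¬ w.support ⊆ F := by
  simp [complexOf]

theorem isLowerSet_complexOf (L : Set (σ →₀ ℕ)) :
    IsLowerSet (complexOf L : Set (Finset σ)) := by
  intro F G hGF hF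
  rw [Finset.mem_coe, mem_complexOf] at hF ⊢
  exact fun w hw h => hF w hw (h.trans hGF)

theorem le_of_support_subset {w m : σ →₀ ℕ} (hw : ∀ t, w t ≤ 1) (h : w.support ⊆ m.support) :
    w ≤ m := by
  intro t
  by_cases ht : w t = 0
  · rw [ht]
    exact Nat.zero_le _
  · have := Finsupp.mem_support_iff.1 (h (Finsupp.mem_support_iff.2 ht))
    have := hw t
    omega

variable {K : Type*} [Field K]

/-- For squarefree generators, divisibility is inclusion of supports. -/
theorem span_eq_faceIdeal {L : Set (σ →₀ ℕ)} (hL : ∀ w ∈ L, ∀ t, w t ≤ 1) :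
    Ideal.span ((fun w => monomial w (1 : K)) '' L) = faceIdeal K (complexOf L) := by
  ext p
  rw [mem_faceIdeal (isLowerSet_complexOf L), mem_ideal_span_monomial_image]
  refine forall₂_congr fun m _ => ?_
  rw [mem_complexOf]
  push Not
  exact exists_congr fun w => and_congr_right fun hw =>
    ⟨fun h => Finsupp.support_mono h, le_of_support_subset (hL w hw)⟩

theorem mem_stanleyReisner_faceIdeal {Δ : Finset (Finset σ)}
    (hΔ : IsLowerSet (Δ : Set (Finset σ))) {F : Finset σ} :
    F ∈ stanleyReisner (faceIdeal K Δ) ↔ F.Nonempty ∧ F ∈ Δ := by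
  refine and_congr_right fun _ => ?_
  have : ∏ s ∈ F, (X s : MvPolynomial σ K) = monomial (∑ s ∈ F, Finsupp.single s 1) 1 := by
    rw [monomial_sum_one]
    rfl
  have hsupp : (∑ s ∈ F, Finsupp.single s 1 : σ →₀ ℕ).support = F := by
    ext t
    simp [Finsupp.finsetSum_apply, Finsupp.single_apply]
  rw [this, mem_faceIdeal hΔ]
  simp [hsupp]

theorem isDisconnected_of_isSeparatedBy {Δ : Finset (Finset σ)}
    (hΔ : IsLowerSet (Δ : Set (Finset σ))) {W : Finset σ} (h : IsSeparatedBy Δ W) :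
    IsDisconnected (stanleyReisner (faceIdeal K Δ)) := by
  obtain ⟨⟨a, haW, ha⟩, ⟨b, hbW, hb⟩, hF⟩ := h
  refine ⟨{s | s ∈ W ∧ {s} ∈ Δ}, {s | s ∉ W ∧ {s} ∈ Δ}, ⟨a, haW, ha⟩, ⟨b, hbW, hb⟩, ?_, ?_, ?_⟩
  · exact Set.disjoint_left.2 fun s hs hs' => hs'.1 hs.1
  · ext s
    have : ({s} : Finset σ) ∈ stanleyReisner (faceIdeal K Δ) ↔ {s} ∈ Δ := by
      simp [mem_stanleyReisner_faceIdeal hΔ]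
    simp only [Set.mem_union, Set.mem_ofPred_eq, this]
    tauto
  · intro F hFm
    rw [mem_stanleyReisner_faceIdeal hΔ] at hFm
    have hv : ∀ s ∈ F, {s} ∈ Δ := fun s hs => hΔ (Finset.singleton_subset_iff.2 hs) hFm.2
    refine (hF F hFm.2).imp (fun h s hs => ⟨h hs, hv s hs⟩) fun h s hs => ⟨?_, hv s hs⟩
    exact Finset.mem_compl.1 (h hs)

theorem not_isDisconnected_of_isConnected {Δ : Finset (Finset σ)}
    (hΔ : IsLowerSet (Δ : Set (Finset σ))) (h : IsConnected Δ) :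
    ¬ IsDisconnected (stanleyReisner (faceIdeal K Δ)) := by
  classical
  rintro ⟨V₁, V₂, ⟨a, ha⟩, ⟨b, hb⟩, hdisj, hunion, hF⟩
  have hv : ∀ s ∈ V₁ ∪ V₂, {s} ∈ Δ := fun s hs => by
    rw [hunion] at hs
    exact ((mem_stanleyReisner_faceIdeal hΔ).1 hs).2
  obtain ⟨c, hc, d, hd, hcd⟩ := h.2 V₁.toFinset a (by simpa using ha) b
    (by simpa using fun h => Set.disjoint_left.1 hdisj h hb) (hv a (Or.inl ha)) (hv b (Or.inr hb))
  rw [Set.mem_toFinset] at hc hd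
  rcases hF {c, d} ((mem_stanleyReisner_faceIdeal hΔ).2 ⟨by simp, hcd⟩) with h | h
  · exact hd (h (by simp))
  · exact Set.disjoint_left.1 hdisj hc (h (by simp))

end Complex

/-! ### The lexicographic order on squarefree quadratic monomials -/

variable {n : ℕ}

theorem quad_apply (a b t : Fin n) :
    quad a b t = (if a = t then 1 else 0) + if b = t then 1 else 0 := by
  simp [quad, Finsupp.single_apply]

theorem quad_support (a b : Fin n) : (quad a b).support = {a, b} := by
  ext t
  simp only [Finsupp.mem_support_iff, quad_apply, Finset.mem_insert, Finset.mem_singleton]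
  grind

theorem quad_lt_quad {a b c d : Fin n} (hab : a < b) (hcd : c < d)
    (h : c < a ∨ c = a ∧ d < b) : toLex (quad a b) < toLex (quad c d) := by
  rw [Finsupp.Lex.lt_iff]
  simp only [ofLex_toLex, quad_apply]
  rcases h with h | ⟨rfl, h⟩
  · exact ⟨c, by grind, by grind⟩
  · exact ⟨d, by grind, by grind⟩

theorem quad_le_quad_iff {a b c d : Fin n} (hab : a < b) (hcd : c < d) :
    quad a b ≼[MonomialOrder.lex] quad c d ↔ c < a ∨ c = a ∧ d ≤ b := by
  rw [MonomialOrder.lex_le_iff]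
  constructor
  · intro h
    by_contra h'
    exact absurd (quad_lt_quad hcd hab (by grind)) h.not_gt
  · rintro (h | ⟨rfl, h⟩)
    · exact (quad_lt_quad hab hcd (Or.inl h)).le
    · rcases h.lt_or_eq with h | rfl
      · exact (quad_lt_quad hab hcd (Or.inr ⟨rfl, h⟩)).le
      · exact le_rfl

theorem quad_comm (a b : Fin n) : quad a b = quad b a := add_comm _ _

theorem exists_quad_eq {w : Fin n →₀ ℕ} (h1 : ∀ t, w t ≤ 1) (h2 : w.degree = 2) :
    ∃ a b, a < b ∧ w = quad a b := by
  have hone : ∀ t ∈ w.support, w t = 1 := fun t ht => by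
    have := Finsupp.mem_support_iff.1 ht
    have := h1 t
    omega
  have hcard : w.support.card = 2 := by
    rw [← h2, Finsupp.degree_apply, Finset.sum_congr rfl hone, Finset.card_eq_sum_ones]
  obtain ⟨a, b, hab, hs⟩ := Finset.card_eq_two.1 hcard
  have hw : w = quad a b := by
    ext t
    rw [quad_apply]
    by_cases ht : t ∈ w.support
    · rw [hone t ht]
      rw [hs] at ht
      grind
    · rw [Finsupp.notMem_support_iff.1 ht]
      rw [hs] at ht
      grind
  rcases lt_or_gt_of_ne hab with h | h
  · exact ⟨a, b, h, hw⟩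
  · exact ⟨b, a, h, hw.trans (quad_comm a b)⟩

theorem quad_mem_lexsegment_iff {a b p q r z : Fin n} (hab : a < b) (hzp : z < p) (hqr : q < r) :
    quad a b ∈ lexsegment (quad z p) (quad q r) ↔
      (z < a ∨ z = a ∧ p ≤ b) ∧ (a < q ∨ a = q ∧ b ≤ r) := by
  rw [lexsegment, Set.mem_ofPred_eq, quad_le_quad_iff hab hzp, quad_le_quad_iff hqr hab]
  have h1 : ∀ t, quad a b t ≤ 1 := fun t => by
    rw [quad_apply]
    grind
  have h2 : (quad a b).degree = 2 := by simp [quad, Finsupp.degree_single]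
  simp [h1, h2]

theorem mem_complexOf_lexsegment {p q r z : Fin n} (hzp : z < p) (hqr : q < r)
    {F : Finset (Fin n)} :
    F ∈ complexOf (lexsegment (quad z p) (quad q r)) ↔ ∀ a ∈ F, ∀ b ∈ F, a < b →
      ¬ ((z < a ∨ z = a ∧ p ≤ b) ∧ (a < q ∨ a = q ∧ b ≤ r)) := by
  rw [mem_complexOf]
  constructor
  · intro h a ha b hb hab hE
    refine h _ ((quad_mem_lexsegment_iff hab hzp hqr).2 hE) ?_
    rw [quad_support]
    exact Finset.insert_subset ha (by simpa using hb)
  · intro h w hw hwF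
    obtain ⟨a, b, hab, rfl⟩ := exists_quad_eq hw.1 hw.2.1
    rw [quad_support, Finset.insert_subset_iff, Finset.singleton_subset_iff] at hwF
    exact h a hwF.1 b hwF.2 hab ((quad_mem_lexsegment_iff hab hzp hqr).1 hw)

theorem singleton_mem_complexOf_lexsegment {p q r z : Fin n} (hzp : z < p) (hqr : q < r)
    (a : Fin n) : {a} ∈ complexOf (lexsegment (quad z p) (quad q r)) := by
  rw [mem_complexOf_lexsegment hzp hqr]
  grind

theorem pair_mem_complexOf_lexsegment {p q r z : Fin n} (hzp : z < p) (hqr : q < r)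
    {a b : Fin n} (hab : a < b)
    (h : ¬ ((z < a ∨ z = a ∧ p ≤ b) ∧ (a < q ∨ a = q ∧ b ≤ r))) :
    {a, b} ∈ complexOf (lexsegment (quad z p) (quad q r)) := by
  rw [mem_complexOf_lexsegment hzp hqr]
  intro c hc d hd hcd
  have : c = a ∧ d = b := by grind
  rwa [this.1, this.2]

/-- For a < p ≤ b the product x_a x_b is at most u; the numerical condition makes it at least v. So
no face crosses the cut at `p`. -/
theorem isSeparatedBy_lexsegment {p q r z : Fin n} (hz : (z : ℕ) = 0) (hzp : z < p) (hqr : q < r)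
    (h : (p : ℕ) ≤ q ∨ (p : ℕ) = q + 1 ∧ (r : ℕ) = n - 1) :
    IsSeparatedBy (complexOf (lexsegment (quad z p) (quad q r)))
      (Finset.univ.filter fun t => t < p) := by
  refine ⟨⟨z, by simpa using hzp, singleton_mem_complexOf_lexsegment hzp hqr z⟩,
    ⟨p, by simp, singleton_mem_complexOf_lexsegment hzp hqr p⟩, fun F hF => ?_⟩
  rw [mem_complexOf_lexsegment hzp hqr] at hF
  by_contra! hcon
  obtain ⟨h1, h2⟩ := hcon
  obtain ⟨b, hb, hbp⟩ := Finset.not_subset.1 h1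
  obtain ⟨a, ha, hap⟩ := Finset.not_subset.1 h2
  simp only [Finset.mem_compl, Finset.mem_filter, Finset.mem_univ, true_and, not_not] at hap hbp
  refine hF a ha b hb (by omega) ⟨by omega, ?_⟩
  simp only [Fin.lt_def, Fin.le_def, Fin.ext_iff] at *
  omega

/-- Pairs {z, y} with y < p lie above u, and pairs {x, m} with x > q and m the last vertex lie below
v, so they are faces. They link all vertices once `z` is linked to `m`. -/
theorem isConnected_lexsegment {p q r z : Fin n} (hz : (z : ℕ) = 0) (hzp : z < p) (hqr : q < r)
    (hzq : z < q) (h : ¬ ((p : ℕ) ≤ q ∨ (p : ℕ) = q + 1 ∧ (r : ℕ) = n - 1)) :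
    IsConnected (complexOf (lexsegment (quad z p) (quad q r))) := by
  refine ⟨⟨z, p, hzp.ne, singleton_mem_complexOf_lexsegment hzp hqr z,
    singleton_mem_complexOf_lexsegment hzp hqr p⟩, fun W a ha b hb _ _ => ?_⟩
  by_contra! hcon
  have key : ∀ x y : Fin n, x < y →
      ¬ ((z < x ∨ z = x ∧ p ≤ y) ∧ (x < q ∨ x = q ∧ y ≤ r)) → (x ∈ W ↔ y ∈ W) := by
    intro x y hxy hE
    have hp := pair_mem_complexOf_lexsegment hzp hqr hxy hE
    constructor
    · exact fun hx => by_contra fun hy => hcon x hx y hy hp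
    · exact fun hy => by_contra fun hx => hcon y hy x hx (by rwa [Finset.pair_comm])
  simp only [Fin.lt_def, Fin.le_def, Fin.ext_iff] at *
  obtain ⟨m, hm⟩ : ∃ m : Fin n, (m : ℕ) = n - 1 := ⟨⟨n - 1, by omega⟩, rfl⟩
  have hhigh : ∀ x : Fin n, (q : ℕ) < x → (x ∈ W ↔ m ∈ W) := fun x hx => by
    by_cases hxm : (x : ℕ) = m
    · rw [Fin.ext hxm]
    · exact key x m (by omega) (by omega)
  -- If p = q + 1, then r is not the last index, so x_q x_m lies below v and `q` is the link.
  -- Otherwise q + 1 < p, and the vertex q + 1 is adjacent to `z` and either adjacent or equal to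
  -- `m`.
  have hzm : z ∈ W ↔ m ∈ W := by
    by_cases hp : (p : ℕ) = q + 1
    · exact (key z q hzq (by omega)).trans (key q m (by omega) (by omega))
    · obtain ⟨s, hs⟩ : ∃ s : Fin n, (s : ℕ) = q + 1 := ⟨⟨q + 1, by omega⟩, rfl⟩
      exact (key z s (by omega) (by omega)).trans (hhigh s (by omega))
  have hall : ∀ x : Fin n, x ∈ W ↔ m ∈ W := fun x => by
    by_cases hx : (q : ℕ) < x
    · exact hhigh x hx
    · by_cases hx0 : (x : ℕ) = z
      · rwa [Fin.ext hx0]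
      · exact (key z x (by omega) (by omega)).symm.trans hzm
  exact hb ((hall b).2 ((hall a).1 ha))

end LexsegmentEdge

end

/-! ### The three equivalences. -/

theorem proposition1p3 (K : Type*) [Field K] (n i j k : ℕ)
    (hi : 2 ≤ i) (hin : i ≤ n) (hj : 2 ≤ j) (hjk : j < k) (hkn : k ≤ n)
    (u v w : Fin n →₀ ℕ)
    (hu : u = LexsegmentEdge.quad (LexsegmentEdge.idx n 1 (by omega))
      (LexsegmentEdge.idx n i (by omega)))
    (hv : v = LexsegmentEdge.quad (LexsegmentEdge.idx n j (by omega))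
      (LexsegmentEdge.idx n k (by omega)))
    (hw : w = LexsegmentEdge.quad (LexsegmentEdge.idx n (i - 1) (by omega))
      (LexsegmentEdge.idx n n (by omega)))
    (I : Ideal (MvPolynomial (Fin n) K)) (hI : I = LexsegmentEdge.lexsegmentIdeal K u v) :
    (LexsegmentEdge.depth (MvPolynomial.idealOfVars (Fin n) K) (MvPolynomial (Fin n) K ⧸ I) = 1 ↔
        v ≼[MonomialOrder.lex] w) ∧
      (CategoryTheory.projectiveDimension
          (ModuleCat.of (MvPolynomial (Fin n) K) (MvPolynomial (Fin n) K ⧸ I)) = (n - 1 : ℕ) ↔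
        v ≼[MonomialOrder.lex] w) ∧
      (LexsegmentEdge.IsDisconnected (LexsegmentEdge.stanleyReisner I) ↔
        v ≼[MonomialOrder.lex] w) := by
  subst hu hv hw
  have hzp : LexsegmentEdge.idx n 1 (by omega) < LexsegmentEdge.idx n i (by omega) := by
    simp only [LexsegmentEdge.idx, Fin.lt_def]
    omega
  have hqr : LexsegmentEdge.idx n j (by omega) < LexsegmentEdge.idx n k (by omega) := by
    simp only [LexsegmentEdge.idx, Fin.lt_def]
    omega
  have hzq : LexsegmentEdge.idx n 1 (by omega) < LexsegmentEdge.idx n j (by omega) := by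
    simp only [LexsegmentEdge.idx, Fin.lt_def]
    omega
  have hw : LexsegmentEdge.idx n (i - 1) (by omega) < LexsegmentEdge.idx n n (by omega) := by
    simp only [LexsegmentEdge.idx, Fin.lt_def]
    omega
  -- In terms of the original indices: i ≤ j, or i = j + 1 and k = n. The shifts by one come from
  -- indexing variables from 0.
  have hcond : LexsegmentEdge.quad (LexsegmentEdge.idx n j (by omega))
        (LexsegmentEdge.idx n k (by omega)) ≼[MonomialOrder.lex]
      LexsegmentEdge.quad (LexsegmentEdge.idx n (i - 1) (by omega))
        (LexsegmentEdge.idx n n (by omega)) ↔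
      i - 1 ≤ j - 1 ∨ i - 1 = j - 1 + 1 ∧ k - 1 = n - 1 := by
    rw [LexsegmentEdge.quad_le_quad_iff hqr hw]
    simp only [LexsegmentEdge.idx, Fin.lt_def, Fin.le_def, Fin.ext_iff]
    omega
  rw [LexsegmentEdge.lexsegmentIdeal, LexsegmentEdge.span_eq_faceIdeal fun w hw => hw.1] at hI
  subst hI
  rw [hcond]
  have hlow := LexsegmentEdge.isLowerSet_complexOf (LexsegmentEdge.lexsegment
    (LexsegmentEdge.quad (LexsegmentEdge.idx n 1 (by omega)) (LexsegmentEdge.idx n i (by omega)))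
    (LexsegmentEdge.quad (LexsegmentEdge.idx n j (by omega)) (LexsegmentEdge.idx n k (by omega))))
  by_cases h : i - 1 ≤ j - 1 ∨ i - 1 = j - 1 + 1 ∧ k - 1 = n - 1
  · have hsep := LexsegmentEdge.isSeparatedBy_lexsegment rfl hzp hqr h
    have hpd := hsep.projectiveDimension_eq (K := K) hlow
    rw [Fintype.card_fin] at hpd
    exact ⟨iff_of_true (hsep.depth_eq_one hlow) h, iff_of_true hpd h,
      iff_of_true (LexsegmentEdge.isDisconnected_of_isSeparatedBy hlow hsep) h⟩
  · have hcon := LexsegmentEdge.isConnected_lexsegment rfl hzp hqr hzq h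
    have hpd := hcon.projectiveDimension_ne (K := K) hlow
    rw [Fintype.card_fin] at hpd
    refine ⟨iff_of_false (fun h1 => ?_) h, iff_of_false hpd h,
      iff_of_false (LexsegmentEdge.not_isDisconnected_of_isConnected hlow hcon) h⟩
    have h2 := hcon.two_le_depth (K := K) hlow
    rw [h1] at h2
    exact absurd h2 (by decide)
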